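/- Let $0<a<1$ and $b\in\mathbb R$, let $\mathbb U$ be the open unit disc of $\mathbb C$, and let powers $z^{a}$ be principal, $-\pi<\arg z\le\pi$. Let $f(x,y)$ be a real-valued function of $x\in[0,1]$, $y\in\mathbb R$, and let $F(z,t)$ be a complex-valued function of $z\in\overline{\mathbb U}\setminus\{0\}$, $t\in\mathbb C$, such that (i) $f(x,y)=\operatorname{Re}F(x,y)$ for all $x\in(0,1]$ and $y\in\mathbb R$ (in particular, $F$ may be an analytic continuation of $f$, i.e. $F(x,y)=f(x,y)$ for these $x,y$); (ii) $F$ is analytic on $\{z\in\mathbb U: z\neq0,\ -\pi<\arg z<\pi\}\times\mathbb C$ and, as a function of $(|z|,\arg z,t)$, continuous for $0<|z|\le1$, $-\pi<\arg z\le\pi$, $t\in\mathbb C$; and $z^{a}F(z,t)$ extends to $z=0$ so as to be analytic on $\mathbb U\times\mathbb C$ and continuous on $\overline{\mathbb U}\times\mathbb C$; (iii) there are an integer $n_0\ge1$, a real number $c\ge0$ and a function $h$, analytic on $\mathbb U$ and continuous on $\overline{\mathbb U}$ with $h(0)=0$, such that $$|z^{a}F(z,t)|\le c\,|t-b|^{n_0}+|h(z)|\qquad\text{for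 all } z\in\overline{\mathbb U}\setminus\{0\},\ t\in\mathbb C .$$ Then there are $R_0\in(0,1]$ and a function $u$, continuous on $[0,R_0]$ and real analytic on $(0,R_0)$, with $u(0)=b$ and $$\frac1{\Gamma(1-a)}\int_0^x\frac{u'(s)}{(x-s)^{a}}\,ds=f(x,u(x))\qquad\text{for all }x\in(0,R_0],$$ the integral being absolutely convergent. That is, the initial value problem ${}^{C}\!D^{a}u(x)=f(x,u(x))$, $u(0)=b$, with the Caputo derivative of order $a$, has at least one solution on $[0,R_0]$ that is continuous on $[0,R_0]$ and real analytic on $(0,R_0)$. -/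

import Mathlib

open Set Metric Function

/-- The space `𝓑⁰`: functions analytic on the open unit disc, continuous on the closed unit
disc and vanishing at the origin. -/
def MemBZero (h : ℂ → ℂ) : Prop :=
  DiffContOnCl ℂ h (ball 0 1) ∧ h 0 = 0

/-- The open unit disc cut along `(-1, 0]`, i.e. `{z : |z| < 1, -π < arg z < π}`. -/
def slitDisc : Set ℂ := ball 0 1 ∩ Complex.slitPlane

/-- The points of the closed unit disc at which `-π < arg z ≤ π` is defined: all but the origin. -/
def puncturedClosedDisc : Set ℂ := closedBall 0 1 \ {0}

/-- The analyticity condition on `F(z,t)`. Powers `z ^ a` are principal, with `-π < arg z ≤ π`.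
* `F` is analytic on the cut disc times `ℂ`;
* `F` is continuous in `(|z|, arg z, t)` for `0 < |z| ≤ 1`, `-π < arg z ≤ π`: the cut
  `arg z = π` belongs to the upper side only, exactly as for `z ^ (-a)`;
* `z ^ a * F z t` extends to a function `G` analytic on the open unit disc times `ℂ` and
  continuous on the closed unit disc times `ℂ`; the extension supplies the value at `z = 0`
  and is the only reason for introducing `G`. -/
structure AnalyticityCondition (a : ℝ) (F : ℂ → ℂ → ℂ) : Prop where
  analytic : AnalyticOnNhd ℂ (uncurry F) (slitDisc ×ˢ (univ : Set ℂ))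
  continuous : ContinuousOn
    (fun p : (ℝ × ℝ) × ℂ => F ((p.1.1 : ℂ) * Complex.exp ((p.1.2 : ℂ) * Complex.I)) p.2)
    ((Ioc (0 : ℝ) 1 ×ˢ Ioc (-Real.pi) Real.pi) ×ˢ (univ : Set ℂ))
  extension : ∃ G : ℂ × ℂ → ℂ,
    AnalyticOnNhd ℂ G (ball (0 : ℂ) 1 ×ˢ (univ : Set ℂ)) ∧
    ContinuousOn G (closedBall (0 : ℂ) 1 ×ˢ (univ : Set ℂ)) ∧
    ∀ z ∈ puncturedClosedDisc, ∀ t : ℂ, G (z, t) = z ^ (a : ℂ) * F z t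

/-- The Caputo derivative of order `a ∈ (0,1)` with base point `0`:
`(1 / Γ(1-a)) ∫₀ˣ u'(s) (x-s)^(-a) ds`. -/
noncomputable def caputoDeriv (a : ℝ) (u : ℝ → ℝ) (x : ℝ) : ℝ :=
  (Real.Gamma (1 - a))⁻¹ * ∫ s in (0 : ℝ)..x, (x - s) ^ (-a) * deriv u s

/-- `u` solves `ᶜDᵃ u(x) = f(x, u(x))`, `u(0) = b`, on the interval `[0, R]`; the integral that
defines the Caputo derivative has to converge absolutely at every `x ∈ (0, R]`. -/
structure IsCaputoSolution (a b : ℝ) (f : ℝ → ℝ → ℝ) (R : ℝ) (u : ℝ → ℝ) : Prop where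
  continuousOn : ContinuousOn u (Icc 0 R)
  differentiableOn : DifferentiableOn ℝ u (Ioo 0 R)
  initial : u 0 = b
  integrable : ∀ x ∈ Ioc 0 R,
    IntervalIntegrable (fun s => (x - s) ^ (-a) * deriv u s) MeasureTheory.volume 0 x
  equation : ∀ x ∈ Ioc 0 R, caputoDeriv a u x = f x (u x)

/-! For fixed z the growth bound and Cauchy's estimates make z^a F(z,t) a polynomial in t of degree
at most n₀. On the real axis its real part is Σⱼ Aⱼ(x) (y-b)^j, where the Aⱼ are convergent real
power series (`exists_polynomial_coefficients`). So the task is to solve x^a ᶜDᵃu = Σⱼ Aⱼ(x)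
(u-b)^j. Since h(0) = 0, the bound at z = 0 gives A₀(0) = 0, and γ = A₁(0) = 0 as soon as n₀ ≥ 2.

For k ≥ 1 the operator x^a ᶜDᵃ multiplies x^k by λₖ = Γ(k+1)/Γ(k+1-a), a positive, strictly
increasing sequence that tends to infinity. With u = b + Σ vₖ x^k, k ≥ 1, the equation reads (λₖ-γ)
vₖ = terms in earlier coefficients. If γ is none of the λₖ, k ≥ 1, the divisors stay away from 0,
and a fixed-point iteration in a weighted ℓ¹ norm gives a convergent solution
(`exists_formal_solution`).

If γ = λₘ for some m ≥ 1, then γ > 0, hence n₀ = 1 and the equation is linear. As in Frobenius'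
method a term c(x) log x is added: x^a ᶜDᵃ(x^k log x) = x^k (λₖ log x + μₖ), and the number μₘ
removes the obstruction at index m, provided that μₘ ≠ 0. That is `caputoLogCoeff_pos`. Linearity
prevents higher powers of the logarithm. In both cases the series may be differentiated term by term
(`hasSum_caputoDeriv_logSeries`), so u is a genuine solution. -/

open PowerSeries in
/-- The weighted `ℓ¹` norm `∑ |fₖ| rᵏ` of a power series is at most `C`. -/
def HasL1Bound (r : ℝ) (f : PowerSeries ℝ) (C : ℝ) : Prop :=
  ∀ N : ℕ, ∑ k ∈ Finset.range N, |coeff k f| * r ^ k ≤ C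

/-! ### Weighted ℓ¹ norms of power series -/

namespace HasL1Bound

open PowerSeries

variable {r C D : ℝ} {f g : PowerSeries ℝ}

theorem summable (hr : 0 ≤ r) (hf : HasL1Bound r f C) :
    Summable fun k => |coeff k f| * r ^ k :=
  summable_of_sum_range_le (fun k => by positivity) hf

theorem tsum_le (hr : 0 ≤ r) (hf : HasL1Bound r f C) : ∑' k, |coeff k f| * r ^ k ≤ C :=
  Real.tsum_le_of_sum_range_le (fun k => by positivity) hf

theorem of_summable (hr : 0 ≤ r) (h : Summable fun k => |coeff k f| * r ^ k) :
    HasL1Bound r f (∑' k, |coeff k f| * r ^ k) :=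
  fun N => h.sum_le_tsum _ (fun k _ => by positivity)

theorem nonneg (hf : HasL1Bound r f C) : 0 ≤ C := by simpa using hf 0

theorem mono (hf : HasL1Bound r f C) (h : C ≤ D) : HasL1Bound r f D := fun N => (hf N).trans h

theorem mono_radius {s : ℝ} (hs : 0 ≤ s) (hsr : s ≤ r) (hf : HasL1Bound r f C) :
    HasL1Bound s f C := fun N => le_trans (by gcongr) (hf N)

theorem add (hf : HasL1Bound r f C) (hg : HasL1Bound r g D) (hr : 0 ≤ r) :
    HasL1Bound r (f + g) (C + D) := fun N => by
  refine le_trans ?_ (add_le_add (hf N) (hg N))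
  rw [← Finset.sum_add_distrib]
  refine Finset.sum_le_sum fun k _ => ?_
  rw [← add_mul, map_add]
  gcongr
  exact abs_add_le _ _

/-- The triangle inequality in the Cauchy product, then rearrangement of the double sum.
Submultiplicativity is what controls the nonlinear terms Aⱼ vʲ. -/
theorem mul (hf : HasL1Bound r f C) (hg : HasL1Bound r g D) (hr : 0 ≤ r) :
    HasL1Bound r (f * g) (C * D) := by
  have hx := hf.summable hr
  have hy := hg.summable hr
  have hx' : Summable fun k => ‖|coeff k f| * r ^ k‖ := hx.norm
  have hy' : Summable fun k => ‖|coeff k g| * r ^ k‖ := hy.norm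
  have hs := (summable_norm_sum_mul_antidiagonal_of_summable_norm hx' hy').of_norm
  intro N
  calc ∑ k ∈ Finset.range N, |coeff k (f * g)| * r ^ k
      ≤ ∑ k ∈ Finset.range N, ∑ ij ∈ Finset.HasAntidiagonal.antidiagonal k,
          (|coeff ij.1 f| * r ^ ij.1) * (|coeff ij.2 g| * r ^ ij.2) := by
        refine Finset.sum_le_sum fun k _ => ?_
        rw [coeff_mul]
        calc _ ≤ (∑ p ∈ Finset.HasAntidiagonal.antidiagonal k, |coeff p.1 f * coeff p.2 g|) * r ^ k := by
              gcongr; exact Finset.abs_sum_le_sum_abs _ _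
          _ = _ := by
              rw [Finset.sum_mul]
              refine Finset.sum_congr rfl fun p hp => ?_
              rw [← Finset.HasAntidiagonal.mem_antidiagonal.1 hp, abs_mul, pow_add]; ring
    _ ≤ ∑' k, ∑ ij ∈ Finset.HasAntidiagonal.antidiagonal k,
          (|coeff ij.1 f| * r ^ ij.1) * (|coeff ij.2 g| * r ^ ij.2) :=
        hs.sum_le_tsum _ (fun k _ => Finset.sum_nonneg fun _ _ => by positivity)
    _ = (∑' k, |coeff k f| * r ^ k) * ∑' k, |coeff k g| * r ^ k :=
        (tsum_mul_tsum_eq_tsum_sum_antidiagonal_of_summable_norm hx' hy').symm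
    _ ≤ C * D := mul_le_mul (hf.tsum_le hr) (hg.tsum_le hr)
        (tsum_nonneg fun k => by positivity) hf.nonneg

theorem monomial (n : ℕ) (x : ℝ) (hr : 0 ≤ r) :
    HasL1Bound r (PowerSeries.monomial n x) (|x| * r ^ n) := fun N => by
  have : ∀ k, |coeff k (PowerSeries.monomial n x)| * r ^ k = if k = n then |x| * r ^ n else 0 := by
    intro k
    rw [coeff_monomial]
    split_ifs with h <;> simp [h]
  simp only [this, Finset.sum_ite_eq']
  split_ifs
  · exact le_rfl
  · positivity

theorem C_const (x : ℝ) (hr : 0 ≤ r) : HasL1Bound r (PowerSeries.C x) |x| := by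
  simpa using monomial (r := r) 0 x hr

theorem X_pow (n : ℕ) (hr : 0 ≤ r) : HasL1Bound r ((X : PowerSeries ℝ) ^ n) (r ^ n) := by
  simpa [X_pow_eq] using monomial (r := r) n 1 hr

theorem pow (hf : HasL1Bound r f C) (hr : 0 ≤ r) (n : ℕ) : HasL1Bound r (f ^ n) (C ^ n) := by
  induction n with
  | zero => simpa using C_const (r := r) 1 hr
  | succ n ih => simpa only [pow_succ] using ih.mul hf hr

theorem sum {ι : Type*} (s : Finset ι) {F : ι → PowerSeries ℝ} {B : ι → ℝ} (hr : 0 ≤ r)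
    (h : ∀ i ∈ s, HasL1Bound r (F i) (B i)) : HasL1Bound r (∑ i ∈ s, F i) (∑ i ∈ s, B i) := by
  classical
  induction s using Finset.induction_on with
  | empty => intro N; simp
  | insert i s hi ih =>
    rw [Finset.sum_insert hi, Finset.sum_insert hi]
    exact (h i (by simp)).add (ih fun j hj => h j (by simp [hj])) hr

/-- A series without constant term has small norm for small weights. -/
theorem of_X_dvd {R : ℝ} (hR : 0 < R) (hf : HasL1Bound R f C) (h0 : constantCoeff f = 0)
    (hr : 0 ≤ r) (hrR : r ≤ R) : HasL1Bound r f (C / R * r) := fun N => by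
  calc ∑ k ∈ Finset.range N, |coeff k f| * r ^ k
      ≤ ∑ k ∈ Finset.range N, |coeff k f| * R ^ k * (r / R) := by
        refine Finset.sum_le_sum fun k _ => ?_
        rcases k with _ | k
        · simp [h0]
        · have : r ^ (k + 1) ≤ R ^ (k + 1) * (r / R) := by
            rw [pow_succ, pow_succ]
            have : r ^ k ≤ R ^ k := by gcongr
            calc r ^ k * r ≤ R ^ k * r := by gcongr
              _ = _ := by field_simp
          calc _ ≤ |coeff (k + 1) f| * (R ^ (k + 1) * (r / R)) := by gcongr
            _ = _ := by ring
    _ ≤ C * (r / R) := by rw [← Finset.sum_mul]; gcongr; exact hf N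
    _ = _ := by ring

end HasL1Bound

/-! ### Fixed points in formal power series, with convergence -/

section Formal

open PowerSeries

variable (D : ℕ → ℝ) (A : ℕ → PowerSeries ℝ) (n : ℕ)

/-- One step of the fixed-point iteration for `Dₖ vₖ = [Xᵏ] ∑ⱼ Aⱼ vʲ`. -/
noncomputable def formalStep (v : PowerSeries ℝ) : PowerSeries ℝ :=
  PowerSeries.mk fun k => (D k)⁻¹ * coeff k (∑ j ∈ Finset.range (n + 1), A j * v ^ j)

variable {D A n}

theorem constantCoeff_formalStep (h0 : constantCoeff (A 0) = 0) {v : PowerSeries ℝ}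
    (hv : constantCoeff v = 0) : constantCoeff (formalStep D A n v) = 0 := by
  rw [← coeff_zero_eq_constantCoeff_apply, formalStep, coeff_mk,
    coeff_zero_eq_constantCoeff_apply, map_sum, Finset.sum_eq_zero, mul_zero]
  intro j _
  rcases j with _ | j
  · simp [h0]
  · simp [hv]

/-- The step is an X-adic contraction. The linear term gains a factor X from A₁; for j ≥ 2, v^j -
w^j is v - w times a sum whose every summand contains v or w, hence X. -/
theorem X_pow_dvd_formalStep_sub (h1 : constantCoeff (A 1) = 0) {v w : PowerSeries ℝ}
    (hv : constantCoeff v = 0) (hw : constantCoeff w = 0) {N : ℕ}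
    (h : (X : PowerSeries ℝ) ^ N ∣ v - w) :
    (X : PowerSeries ℝ) ^ (N + 1) ∣ formalStep D A n v - formalStep D A n w := by
  have key : (X : PowerSeries ℝ) ^ (N + 1) ∣
      (∑ j ∈ Finset.range (n + 1), A j * v ^ j) - ∑ j ∈ Finset.range (n + 1), A j * w ^ j := by
    rw [← Finset.sum_sub_distrib]
    refine Finset.dvd_sum fun j _ => ?_
    rw [← mul_sub]
    rcases j with _ | _ | j
    · simp
    · rw [pow_succ', zero_add, pow_one, pow_one]
      exact mul_dvd_mul (X_dvd_iff.2 h1) h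
    · rw [← (Commute.all v w).mul_geom_sum₂, pow_succ]
      refine Dvd.dvd.mul_left (mul_dvd_mul h (Finset.dvd_sum fun i hi => ?_)) _
      rcases i with _ | i
      · refine Dvd.dvd.mul_left ?_ _
        exact dvd_pow (X_dvd_iff.2 hw) (by omega)
      · exact Dvd.dvd.mul_right (dvd_pow (X_dvd_iff.2 hv) (by omega)) _
  rw [X_pow_dvd_iff] at key ⊢
  intro m hm
  have := key m hm
  rw [map_sub] at this
  simp only [formalStep, map_sub, coeff_mk]
  rw [← mul_sub, this, mul_zero]

theorem hasL1Bound_formalStep {r δ B : ℝ} (hr : 0 ≤ r) (hδ : 0 < δ) (hD : ∀ k, δ ≤ |D k|)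
    {v : PowerSeries ℝ}
    (h : HasL1Bound r (∑ j ∈ Finset.range (n + 1), A j * v ^ j) B) :
    HasL1Bound r (formalStep D A n v) (δ⁻¹ * B) := fun N => by
  refine le_trans ?_ (mul_le_mul_of_nonneg_left (h N) (by positivity : 0 ≤ δ⁻¹))
  rw [Finset.mul_sum]
  refine Finset.sum_le_sum fun k _ => ?_
  rw [formalStep, coeff_mk, abs_mul, abs_inv, mul_assoc]
  gcongr
  exact hD k


/-- A₀ and A₁ have no constant term, so their norms are O(r); the other terms are O(ρ²). Choosing
first ρ and then r small makes both at most half of δρ. -/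
theorem exists_weight_formalStep {δ : ℝ} (hδ : 0 < δ) (hD : ∀ k, δ ≤ |D k|)
    (h0 : constantCoeff (A 0) = 0) (h1 : constantCoeff (A 1) = 0) {R : ℝ} (hR : 0 < R)
    (hA : ∀ j, ∃ C, HasL1Bound R (A j) C) :
    ∃ r ρ : ℝ, 0 < r ∧ r ≤ R ∧ 0 < ρ ∧
      ∀ v, HasL1Bound r v ρ → HasL1Bound r (formalStep D A n v) ρ := by
  choose B hB using hA
  have hB0 : ∀ j, 0 ≤ B j := fun j => (hB j).nonneg
  obtain ⟨K, hK⟩ : ∃ K, K = 1 + ∑ j ∈ Finset.range (n + 1), B j := ⟨_, rfl⟩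
  have hK1 : 1 ≤ K := by
    have := Finset.sum_nonneg (s := Finset.range (n + 1)) fun j _ => hB0 j
    linarith
  obtain ⟨ρ, hρ⟩ : ∃ ρ, ρ = min 1 (δ / (2 * K)) := ⟨_, rfl⟩
  have hρ0 : 0 < ρ := hρ ▸ lt_min one_pos (by positivity)
  have hρ1 : ρ ≤ 1 := hρ ▸ min_le_left _ _
  have hρK : K * ρ ≤ δ / 2 := by
    calc K * ρ ≤ K * (δ / (2 * K)) := by gcongr; exact hρ ▸ min_le_right _ _
      _ = δ / 2 := by field_simp
  obtain ⟨r, hr⟩ : ∃ r, r = min R (R * (δ * ρ / (2 * K))) := ⟨_, rfl⟩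
  have hr0 : 0 < r := hr ▸ lt_min hR (by positivity)
  have hrR : r ≤ R := hr ▸ min_le_left _ _
  have hrK : K * (r / R) ≤ δ * ρ / 2 := by
    have : r / R ≤ δ * ρ / (2 * K) := by
      rw [div_le_iff₀ hR, mul_comm]; exact hr ▸ min_le_right _ _
    calc K * (r / R) ≤ K * (δ * ρ / (2 * K)) := by gcongr
      _ = _ := by field_simp
  have hq : 0 ≤ r / R := by positivity
  refine ⟨r, ρ, hr0, hrR, hρ0, fun v hv => ?_⟩
  have hterm : ∀ j ∈ Finset.range (n + 1),
      HasL1Bound r (A j * v ^ j) (B j * (r / R + ρ ^ 2)) := by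
    intro j _
    have hvj := hv.pow hr0.le j
    rcases j with _ | _ | j
    · refine (((hB 0).of_X_dvd hR h0 hr0.le hrR).mul hvj hr0.le).mono ?_
      rw [pow_zero, mul_one, div_mul_eq_mul_div, mul_div_assoc]
      exact mul_le_mul_of_nonneg_left (by nlinarith [sq_nonneg ρ]) (hB0 _)
    · refine (((hB 1).of_X_dvd hR h1 hr0.le hrR).mul hvj hr0.le).mono ?_
      rw [zero_add, pow_one, div_mul_eq_mul_div, mul_div_assoc, mul_assoc]
      refine mul_le_mul_of_nonneg_left ?_ (hB0 _)
      nlinarith [sq_nonneg ρ]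
    · refine (((hB _).mono_radius hr0.le hrR).mul hvj hr0.le).mono ?_
      refine mul_le_mul_of_nonneg_left ?_ (hB0 _)
      have h2 : ρ ^ (j + 1 + 1) ≤ ρ ^ 2 := pow_le_pow_of_le_one hρ0.le hρ1 (by omega)
      linarith
  have hsum := hasL1Bound_formalStep (D := D) hr0.le hδ hD
    (HasL1Bound.sum (Finset.range (n + 1)) hr0.le hterm)
  refine hsum.mono ?_
  rw [← Finset.sum_mul, inv_mul_le_iff₀ hδ]
  have hle : ∑ j ∈ Finset.range (n + 1), B j ≤ K := by linarith
  calc _ ≤ K * (r / R + ρ ^ 2) := by gcongr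
    _ = K * (r / R) + (K * ρ) * ρ := by ring
    _ ≤ δ * ρ / 2 + δ / 2 * ρ := by gcongr
    _ = δ * ρ := by ring

/-- The iterates from 0 stabilise coefficientwise, so a limit exists formally. The bound concerns
finitely many coefficients at a time, so it passes from the iterates to the limit. -/
theorem exists_fixedPoint_formalStep (h0 : constantCoeff (A 0) = 0)
    (h1 : constantCoeff (A 1) = 0) {r ρ : ℝ} (hρ : 0 < ρ)
    (step : ∀ v, HasL1Bound r v ρ → HasL1Bound r (formalStep D A n v) ρ) :
    ∃ v, HasL1Bound r v ρ ∧ constantCoeff v = 0 ∧ formalStep D A n v = v := by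
  obtain ⟨V, hV, hVs⟩ : ∃ V : ℕ → PowerSeries ℝ,
      V 0 = 0 ∧ ∀ N, V (N + 1) = formalStep D A n (V N) :=
    ⟨fun N => (formalStep D A n)^[N] 0, rfl, fun N => iterate_succ_apply' _ _ _⟩
  have hV0 : ∀ N, constantCoeff (V N) = 0 := by
    intro N
    induction N with
    | zero => simp [hV]
    | succ N ih => rw [hVs]; exact constantCoeff_formalStep h0 ih
  have hVb : ∀ N, HasL1Bound r (V N) ρ := by
    intro N
    induction N with
    | zero => intro M; simp [hV, hρ.le]
    | succ N ih => rw [hVs]; exact step _ ih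
  have hVd : ∀ N, (X : PowerSeries ℝ) ^ N ∣ V (N + 1) - V N := by
    intro N
    induction N with
    | zero => simp
    | succ N ih =>
      rw [hVs (N + 1), hVs N]
      exact X_pow_dvd_formalStep_sub h1 (by rw [← hVs]; exact hV0 _) (hV0 _) (by rwa [← hVs])
  have hVc : ∀ k M, coeff k (V (k + 1 + M)) = coeff k (V (k + 1)) := by
    intro k M
    induction M with
    | zero => rfl
    | succ M ih =>
      have := X_pow_dvd_iff.1 (hVd (k + 1 + M)) k (by omega)
      rw [map_sub, sub_eq_zero] at this
      rw [← add_assoc, this, ih]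
  obtain ⟨v, hv⟩ : ∃ v : PowerSeries ℝ, ∀ k, coeff k v = coeff k (V (k + 1)) :=
    ⟨PowerSeries.mk fun k => coeff k (V (k + 1)), fun k => coeff_mk _ _⟩
  have hvN : ∀ N, ∀ k < N, coeff k v = coeff k (V N) := by
    intro N k hk
    obtain ⟨M, rfl⟩ := Nat.exists_eq_add_of_le (Nat.succ_le_of_lt hk)
    rw [hv]
    exact (hVc k M).symm
  have hvd : ∀ N, (X : PowerSeries ℝ) ^ N ∣ v - V N := by
    intro N
    rw [X_pow_dvd_iff]
    intro k hk
    rw [map_sub, hvN N k hk, sub_self]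
  have hvc : constantCoeff v = 0 := by
    have := hvN 1 0 one_pos
    rwa [coeff_zero_eq_constantCoeff_apply, coeff_zero_eq_constantCoeff_apply, hV0] at this
  refine ⟨v, fun N => ?_, hvc, ?_⟩
  · rw [Finset.sum_congr rfl fun k hk => by rw [hvN N k (Finset.mem_range.1 hk)]]
    exact hVb N N
  · ext k
    have e1 := X_pow_dvd_iff.1
      (X_pow_dvd_formalStep_sub (D := D) (n := n) h1 hvc (hV0 _) (hvd k)) k (by omega)
    rw [← hVs, map_sub, sub_eq_zero] at e1
    rw [e1, hvN (k + 1) k (by omega)]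

/-- The system `Dₖ vₖ = [Xᵏ] ∑ⱼ Aⱼ vʲ` has a solution with positive radius of convergence. -/
theorem exists_formal_solution (n : ℕ) {δ : ℝ} (hδ : 0 < δ) (hD : ∀ k, δ ≤ |D k|)
    (h0 : constantCoeff (A 0) = 0) (h1 : constantCoeff (A 1) = 0) {R : ℝ} (hR : 0 < R)
    (hA : ∀ j, ∃ C, HasL1Bound R (A j) C) :
    ∃ (v : PowerSeries ℝ) (r C : ℝ), 0 < r ∧ r ≤ R ∧ HasL1Bound r v C ∧ constantCoeff v = 0 ∧
      ∀ k, D k * coeff k v = coeff k (∑ j ∈ Finset.range (n + 1), A j * v ^ j) := by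
  obtain ⟨r, ρ, hr0, hrR, hρ, step⟩ := exists_weight_formalStep (n := n) hδ hD h0 h1 hR hA
  obtain ⟨v, hv, hv0, hfix⟩ := exists_fixedPoint_formalStep h0 h1 hρ step
  refine ⟨v, r, ρ, hr0, hrR, hv, hv0, fun k => ?_⟩
  have hDk : D k ≠ 0 := abs_pos.1 (hδ.trans_le (hD k))
  conv_lhs => rw [← hfix]
  rw [formalStep, coeff_mk, mul_inv_cancel_left₀ hDk]

end Formal

/-! ### Caputo derivatives of x^k and x^k log x -/

section CaputoMonomials

open MeasureTheory

/-- The Caputo derivative of order `a` of `x ^ k` is `caputoCoeff a k * x ^ (k - a)`. -/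
noncomputable def caputoCoeff (a : ℝ) (k : ℕ) : ℝ :=
  Real.Gamma (k + 1) / Real.Gamma (k + 1 - a)

/-- The Caputo derivative of order `a` of `x ^ k * log x` is
`x ^ (k - a) * (caputoCoeff a k * log x + caputoLogCoeff a k)`. -/
noncomputable def caputoLogCoeff (a : ℝ) (k : ℕ) : ℝ :=
  (Real.Gamma (1 - a))⁻¹ *
    ∫ s in (0 : ℝ)..1, (1 - s) ^ (-a) * (k * s ^ (k - 1) * Real.log s + s ^ (k - 1))

variable {a : ℝ}

theorem intervalIntegrable_kernel (ha1 : a < 1) (x y : ℝ) :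
    IntervalIntegrable (fun s : ℝ => (x - s) ^ (-a)) volume y x := by
  have h := (intervalIntegral.intervalIntegrable_rpow' (a := x - y) (b := 0)
    (r := -a) (by linarith)).comp_sub_left x
  simpa using h

/-- The two singularities sit at opposite ends; the midpoint separates them. This function is the
common majorant for the integrands below. -/
theorem intervalIntegrable_kernel_mul_log (ha1 : a < 1) {x : ℝ} (hx : 0 < x) :
    IntervalIntegrable (fun s : ℝ => (x - s) ^ (-a) * (|Real.log s| + 1)) volume 0 x := by
  have hl : IntervalIntegrable (fun s : ℝ => |Real.log s| + 1) volume 0 (x / 2) :=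
    intervalIntegral.intervalIntegrable_log'.abs.add intervalIntegrable_const
  refine IntervalIntegrable.trans (b := x / 2) ?_ ?_
  · refine hl.continuousOn_mul ?_
    intro s hs
    rw [uIcc_of_le (by linarith)] at hs
    refine ContinuousAt.continuousWithinAt ?_
    exact ContinuousAt.rpow_const (by fun_prop) (Or.inl (by linarith [hs.2]))
  · refine (intervalIntegrable_kernel ha1 x _).mul_continuousOn ?_
    intro s hs
    rw [uIcc_of_le (by linarith)] at hs
    have : s ≠ 0 := by linarith [hs.1]
    exact ContinuousAt.continuousWithinAt (by fun_prop (disch := assumption))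

theorem abs_mul_pow_le {x s : ℝ} (hs : 0 < s) (hsx : s ≤ x) (k : ℕ) :
    |(k : ℝ) * s ^ (k - 1)| ≤ (k + 1) * x ^ (k - 1) * (|Real.log s| + 1) := by
  have h : s ^ (k - 1) ≤ x ^ (k - 1) := by gcongr
  have hx : 0 < x := hs.trans_le hsx
  rw [abs_of_nonneg (by positivity)]
  calc (k : ℝ) * s ^ (k - 1) ≤ (k + 1) * x ^ (k - 1) := by gcongr; linarith
    _ ≤ _ := le_mul_of_one_le_right (by positivity) (by linarith [abs_nonneg (Real.log s)])

theorem abs_mul_pow_log_le {x s : ℝ} (hs : 0 < s) (hsx : s ≤ x) (k : ℕ) :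
    |(k : ℝ) * s ^ (k - 1) * Real.log s + s ^ (k - 1)|
      ≤ (k + 1) * x ^ (k - 1) * (|Real.log s| + 1) := by
  have h : s ^ (k - 1) ≤ x ^ (k - 1) := by gcongr
  have hx : 0 < x := hs.trans_le hsx
  calc |(k : ℝ) * s ^ (k - 1) * Real.log s + s ^ (k - 1)|
      ≤ k * s ^ (k - 1) * |Real.log s| + s ^ (k - 1) := by
        refine (abs_add_le _ _).trans (le_of_eq ?_)
        rw [abs_mul, abs_of_nonneg (by positivity : 0 ≤ (k : ℝ) * s ^ (k - 1)),
          abs_of_nonneg (by positivity : 0 ≤ s ^ (k - 1))]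
    _ ≤ (k + 1) * x ^ (k - 1) * |Real.log s| + (k + 1) * x ^ (k - 1) := by
        have hk : (0 : ℝ) ≤ k := Nat.cast_nonneg k
        gcongr
        · linarith
        · calc s ^ (k - 1) ≤ 1 * x ^ (k - 1) := by linarith
            _ ≤ _ := by gcongr; linarith
    _ = _ := by ring

theorem intervalIntegrable_kernel_mul (ha1 : a < 1) {x C : ℝ} (hx : 0 < x) {φ : ℝ → ℝ}
    (hφ : Measurable φ) (hb : ∀ s ∈ Ioo 0 x, |φ s| ≤ C * (|Real.log s| + 1)) :
    IntervalIntegrable (fun s : ℝ => (x - s) ^ (-a) * φ s) volume 0 x := by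
  refine ((intervalIntegrable_kernel_mul_log ha1 hx).const_mul C).mono_fun ?_ ?_
  · exact (by fun_prop : Measurable fun s : ℝ => (x - s) ^ (-a) * φ s).aestronglyMeasurable
  · rw [uIoc_of_le hx.le]
    have h0 : ∀ᵐ s ∂(volume.restrict (Ioc 0 x)), s ≠ x :=
      ae_restrict_of_ae (by simp [ae_iff])
    filter_upwards [ae_restrict_mem measurableSet_Ioc, h0] with s hs hsx
    have hs' : s ∈ Ioo 0 x := ⟨hs.1, lt_of_le_of_ne hs.2 hsx⟩
    have hp : 0 ≤ (x - s) ^ (-a) := Real.rpow_nonneg (by linarith [hs.2]) _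
    rw [Real.norm_eq_abs, Real.norm_eq_abs, abs_mul, abs_of_nonneg hp]
    calc _ ≤ (x - s) ^ (-a) * (C * (|Real.log s| + 1)) := by gcongr; exact hb s hs'
      _ = C * ((x - s) ^ (-a) * (|Real.log s| + 1)) := by ring
      _ ≤ _ := le_abs_self _

theorem intervalIntegrable_kernel_mul_pow (ha1 : a < 1) {x : ℝ} (hx : 0 < x) (k : ℕ) :
    IntervalIntegrable (fun s : ℝ => (x - s) ^ (-a) * (k * s ^ (k - 1))) volume 0 x :=
  intervalIntegrable_kernel_mul ha1 hx (by fun_prop)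
    fun s hs => abs_mul_pow_le hs.1 hs.2.le k

theorem intervalIntegrable_kernel_mul_pow_log (ha1 : a < 1) {x : ℝ} (hx : 0 < x) (k : ℕ) :
    IntervalIntegrable (fun s : ℝ => (x - s) ^ (-a) *
      (k * s ^ (k - 1) * Real.log s + s ^ (k - 1))) volume 0 x :=
  intervalIntegrable_kernel_mul ha1 hx (by fun_prop)
    fun s hs => abs_mul_pow_log_le hs.1 hs.2.le k

theorem integral_kernel_mul_scale {x : ℝ} (hx : 0 < x) (φ : ℝ → ℝ) :
    ∫ s in (0 : ℝ)..x, (x - s) ^ (-a) * φ s =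
      x ^ (1 - a) * ∫ s in (0 : ℝ)..1, (1 - s) ^ (-a) * φ (x * s) := by
  have h : x * ∫ s in (0 : ℝ)..1, (x - x * s) ^ (-a) * φ (x * s) =
      ∫ s in x * 0..x * 1, (x - s) ^ (-a) * φ s :=
    intervalIntegral.mul_integral_comp_mul_left (f := (fun s => (x - s) ^ (-a) * φ s : ℝ → ℝ)) x
  rw [mul_zero, mul_one] at h
  rw [← h, Real.rpow_sub hx, Real.rpow_one, div_eq_mul_inv, mul_assoc, ← Real.rpow_neg hx.le]
  congr 1
  rw [← intervalIntegral.integral_const_mul]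
  refine intervalIntegral.integral_congr fun s hs => ?_
  rw [uIcc_of_le zero_le_one] at hs
  have : x - x * s = x * (1 - s) := by ring
  simp only [this]
  rw [Real.mul_rpow hx.le (by linarith [hs.2])]
  ring

theorem integral_unit_kernel_mul_pow (ha1 : a < 1) {k : ℕ} (hk : 1 ≤ k) :
    ∫ s in (0 : ℝ)..1, (1 - s) ^ (-a) * (k * s ^ (k - 1)) =
      Real.Gamma (1 - a) * caputoCoeff a k := by
  have hk0 : (0 : ℝ) < k := by exact_mod_cast hk
  have h1 : ((∫ s in (0 : ℝ)..1, s ^ (k - 1) * (1 - s) ^ (-a) : ℝ) : ℂ) =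
      Complex.betaIntegral (k : ℂ) ((1 - a : ℝ) : ℂ) := by
    rw [Complex.betaIntegral, ← intervalIntegral.integral_ofReal]
    refine intervalIntegral.integral_congr fun s hs => ?_
    rw [uIcc_of_le zero_le_one] at hs
    rw [Complex.ofReal_mul, Complex.ofReal_cpow (by linarith [hs.2])]
    congr 1
    · rw [Complex.ofReal_pow, ← Complex.cpow_natCast, Nat.cast_sub hk, Nat.cast_one]
    · push_cast; ring_nf
  have h2 : ∫ s in (0 : ℝ)..1, s ^ (k - 1) * (1 - s) ^ (-a) =
      ProbabilityTheory.beta k (1 - a) := by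
    rw [ProbabilityTheory.beta_eq_betaIntegralReal _ _ hk0 (by linarith), Complex.ofReal_natCast,
      ← h1, Complex.ofReal_re]
  have h3 : ∫ s in (0 : ℝ)..1, (1 - s) ^ (-a) * (k * s ^ (k - 1)) =
      k * ∫ s in (0 : ℝ)..1, s ^ (k - 1) * (1 - s) ^ (-a) := by
    rw [← intervalIntegral.integral_const_mul]
    congr 1; ext s; ring
  rw [h3, h2, ProbabilityTheory.beta, caputoCoeff, Real.Gamma_add_one hk0.ne',
    show (k : ℝ) + (1 - a) = k + 1 - a by ring]
  ring

theorem integral_kernel_mul_pow (ha1 : a < 1) {x : ℝ} (hx : 0 < x) {k : ℕ} (hk : 1 ≤ k) :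
    ∫ s in (0 : ℝ)..x, (x - s) ^ (-a) * (k * s ^ (k - 1)) =
      Real.Gamma (1 - a) * (x ^ (-a) * (caputoCoeff a k * x ^ k)) := by
  have h : ∫ s in (0 : ℝ)..1, (1 - s) ^ (-a) * (k * (x * s) ^ (k - 1)) =
      x ^ (k - 1) * ∫ s in (0 : ℝ)..1, (1 - s) ^ (-a) * (k * s ^ (k - 1)) := by
    rw [← intervalIntegral.integral_const_mul]
    congr 1; ext s; rw [mul_pow]; ring
  rw [integral_kernel_mul_scale hx, h, integral_unit_kernel_mul_pow ha1 hk,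
    sub_eq_add_neg 1 a, Real.rpow_add hx, Real.rpow_one]
  obtain ⟨j, rfl⟩ := Nat.exists_eq_add_of_le' hk
  rw [Nat.add_sub_cancel, pow_succ]
  ring

/-- Rescaling to [0,1] splits log(xs) into log x + log s: the first part is the Beta integral of
x^k, the second a constant. -/
theorem integral_kernel_mul_pow_log (ha1 : a < 1) {x : ℝ} (hx : 0 < x) {k : ℕ} (hk : 1 ≤ k) :
    ∫ s in (0 : ℝ)..x, (x - s) ^ (-a) * (k * s ^ (k - 1) * Real.log s + s ^ (k - 1)) =
      Real.Gamma (1 - a) *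
        (x ^ (-a) * ((caputoCoeff a k * Real.log x + caputoLogCoeff a k) * x ^ k)) := by
  have hΓ : Real.Gamma (1 - a) ≠ 0 := (Real.Gamma_pos_of_pos (by linarith)).ne'
  have h : ∫ s in (0 : ℝ)..1, (1 - s) ^ (-a) *
        (k * (x * s) ^ (k - 1) * Real.log (x * s) + (x * s) ^ (k - 1)) =
      ∫ s in (0 : ℝ)..1, (x ^ (k - 1) * Real.log x * ((1 - s) ^ (-a) * (k * s ^ (k - 1))) +
        x ^ (k - 1) * ((1 - s) ^ (-a) * (k * s ^ (k - 1) * Real.log s + s ^ (k - 1)))) := by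
    refine intervalIntegral.integral_congr_ae (ae_of_all _ fun s hs => ?_)
    rw [uIoc_of_le zero_le_one] at hs
    rw [Real.log_mul hx.ne' hs.1.ne', mul_pow]
    ring
  have hP : ∫ s in (0 : ℝ)..1, (1 - s) ^ (-a) * (k * s ^ (k - 1) * Real.log s + s ^ (k - 1)) =
      Real.Gamma (1 - a) * caputoLogCoeff a k := by
    rw [caputoLogCoeff, mul_inv_cancel_left₀ hΓ]
  rw [integral_kernel_mul_scale hx, h, intervalIntegral.integral_add
      ((intervalIntegrable_kernel_mul_pow ha1 one_pos k).const_mul _)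
      ((intervalIntegrable_kernel_mul_pow_log ha1 one_pos k).const_mul _),
    intervalIntegral.integral_const_mul, intervalIntegral.integral_const_mul,
    integral_unit_kernel_mul_pow ha1 hk, hP, sub_eq_add_neg 1 a, Real.rpow_add hx, Real.rpow_one]
  obtain ⟨j, rfl⟩ := Nat.exists_eq_add_of_le' hk
  rw [Nat.add_sub_cancel, pow_succ]
  ring

/-- Linear growth in k is harmless: it costs only a smaller radius of convergence. -/
theorem exists_abs_caputoLogCoeff_le (ha1 : a < 1) :
    ∃ K : ℝ, 0 ≤ K ∧ ∀ k : ℕ, |caputoLogCoeff a k| ≤ (k + 1) * K := by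
  have hΓ : 0 < Real.Gamma (1 - a) := Real.Gamma_pos_of_pos (by linarith)
  have hW := intervalIntegrable_kernel_mul_log ha1 one_pos
  have hW0 : 0 ≤ ∫ s in (0 : ℝ)..1, (1 - s) ^ (-a) * (|Real.log s| + 1) := by
    refine intervalIntegral.integral_nonneg zero_le_one fun s hs => ?_
    have : 0 ≤ (1 - s) ^ (-a) := Real.rpow_nonneg (by linarith [hs.2]) _
    positivity
  refine ⟨(Real.Gamma (1 - a))⁻¹ * ∫ s in (0 : ℝ)..1, (1 - s) ^ (-a) * (|Real.log s| + 1),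
    by positivity, fun k => ?_⟩
  rw [caputoLogCoeff, abs_mul, abs_of_pos (inv_pos.2 hΓ), mul_left_comm]
  gcongr
  rw [← intervalIntegral.integral_const_mul, ← Real.norm_eq_abs]
  refine intervalIntegral.norm_integral_le_of_norm_le zero_le_one
    (ae_of_all _ fun s hs => ?_) (hW.const_mul _)
  have hp : 0 ≤ (1 - s) ^ (-a) := Real.rpow_nonneg (by linarith [hs.2]) _
  rw [Real.norm_eq_abs, abs_mul, abs_of_nonneg hp, mul_left_comm]
  gcongr
  simpa using abs_mul_pow_log_le hs.1 hs.2 k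

theorem integral_deriv_pow_mul_log {k : ℕ} (hk : 1 ≤ k) :
    ∫ s in (0 : ℝ)..1, ((k : ℝ) * s ^ (k - 1) * Real.log s + s ^ (k - 1)) = 0 := by
  obtain ⟨j, rfl⟩ := Nat.exists_eq_add_of_le' hk
  have hint : IntervalIntegrable
      (fun s : ℝ => ((j + 1 : ℕ) : ℝ) * s ^ (j + 1 - 1) * Real.log s + s ^ (j + 1 - 1))
      volume 0 1 := by
    refine IntervalIntegrable.add ?_ (Continuous.intervalIntegrable (by fun_prop) _ _)
    exact intervalIntegral.intervalIntegrable_log'.continuousOn_mul (by fun_prop)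
  -- The primitive s^(j+1) log s vanishes at both ends; the factor s log s makes it visibly
  -- continuous at 0.
  have hc : ContinuousOn (fun s : ℝ => s ^ j * (s * Real.log s)) (Icc 0 1) :=
    ((continuous_pow j).mul Real.continuous_mul_log).continuousOn
  rw [intervalIntegral.integral_eq_sub_of_hasDerivAt_of_le zero_le_one hc _ hint]
  · simp
  · intro s hs
    have h := (hasDerivAt_pow (j + 1) s).mul (Real.hasDerivAt_log hs.1.ne')
    have e : (fun s : ℝ => s ^ j * (s * Real.log s)) = (fun s : ℝ => s ^ (j + 1)) * Real.log := by
      ext s; simp only [Pi.mul_apply]; ring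
    rw [e]
    refine h.congr_deriv ?_
    have : s ≠ 0 := hs.1.ne'
    rw [Nat.add_sub_cancel, pow_succ]
    field_simp

/-- Chebyshev's inequality for the increasing kernel against `d(sᵏ log s)`, which has mean zero
and changes sign once. -/
theorem caputoLogCoeff_pos (ha0 : 0 < a) (ha1 : a < 1) {k : ℕ} (hk : 1 ≤ k) :
    0 < caputoLogCoeff a k := by
  have hk0 : (0 : ℝ) < k := by exact_mod_cast hk
  have hΓ : 0 < Real.Gamma (1 - a) := Real.Gamma_pos_of_pos (by linarith)
  refine mul_pos (inv_pos.2 hΓ) ?_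
  obtain ⟨g, hg⟩ : ∃ g : ℝ → ℝ, g = fun s => (k : ℝ) * s ^ (k - 1) * Real.log s + s ^ (k - 1) :=
    ⟨_, rfl⟩
  -- The zero of k log s + 1, where g changes sign.
  obtain ⟨t, ht⟩ : ∃ t : ℝ, t = Real.exp (-(1 / k)) := ⟨_, rfl⟩
  have ht0 : 0 < t := ht ▸ Real.exp_pos _
  have ht1 : t < 1 := by
    rw [ht, Real.exp_lt_one_iff]
    have : 0 < 1 / (k : ℝ) := by positivity
    linarith
  have hgf : ∀ s, g s = s ^ (k - 1) * (k * Real.log s + 1) := fun s => by rw [hg]; ring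
  have hlt : k * Real.log t + 1 = 0 := by rw [ht, Real.log_exp]; field_simp; ring
  have hgneg : ∀ s ∈ Ioo 0 t, g s < 0 := fun s hs => by
    rw [hgf]
    refine mul_neg_of_pos_of_neg (pow_pos hs.1 _) ?_
    have := Real.log_lt_log hs.1 hs.2
    nlinarith
  have hgpos : ∀ s ∈ Ioo t 1, 0 < g s := fun s hs => by
    rw [hgf]
    refine mul_pos (pow_pos (ht0.trans hs.1) _) ?_
    have := Real.log_lt_log ht0 hs.1
    nlinarith
  have hi1 : IntervalIntegrable (fun s : ℝ => (1 - s) ^ (-a) * g s) volume 0 1 := by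
    rw [hg]; exact intervalIntegrable_kernel_mul_pow_log ha1 one_pos k
  have hi2 : IntervalIntegrable g volume 0 1 := by
    rw [hg]
    refine IntervalIntegrable.add ?_ (Continuous.intervalIntegrable (by fun_prop) _ _)
    exact intervalIntegral.intervalIntegrable_log'.continuousOn_mul (by fun_prop)
  have hi : IntervalIntegrable (fun s : ℝ => ((1 - s) ^ (-a) - (1 - t) ^ (-a)) * g s)
      volume 0 1 := by
    simpa only [sub_mul] using hi1.sub (hi2.const_mul _)
  have hg0 : ∫ s in (0 : ℝ)..1, g s = 0 := by rw [hg]; exact integral_deriv_pow_mul_log hk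
  -- Since g has mean zero, a constant may be subtracted from the kernel; with its value at t, both
  -- factors change sign at t.
  have e : ∫ s in (0 : ℝ)..1, (1 - s) ^ (-a) * g s =
      ∫ s in (0 : ℝ)..1, ((1 - s) ^ (-a) - (1 - t) ^ (-a)) * g s := by
    simp only [sub_mul]
    rw [intervalIntegral.integral_sub hi1 (hi2.const_mul _),
      intervalIntegral.integral_const_mul, hg0, mul_zero, sub_zero]
  have hs1 : uIcc 0 t ⊆ uIcc (0 : ℝ) 1 := by
    rw [uIcc_of_le ht0.le, uIcc_of_le zero_le_one]; exact Icc_subset_Icc_right ht1.le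
  have hs2 : uIcc t 1 ⊆ uIcc (0 : ℝ) 1 := by
    rw [uIcc_of_le ht1.le, uIcc_of_le zero_le_one]; exact Icc_subset_Icc_left ht0.le
  have hpos : 0 < ∫ s in (0 : ℝ)..1, (1 - s) ^ (-a) * g s := by
    rw [e, ← intervalIntegral.integral_add_adjacent_intervals (hi.mono_set hs1)
      (hi.mono_set hs2)]
    refine add_pos ?_ ?_
    · refine intervalIntegral.intervalIntegral_pos_of_pos_on (hi.mono_set hs1) (fun s hs => ?_) ht0
      refine mul_pos_of_neg_of_neg ?_ (hgneg s hs)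
      exact sub_neg.2 (Real.rpow_lt_rpow_of_neg (by linarith) (by linarith [hs.2]) (by linarith))
    · refine intervalIntegral.intervalIntegral_pos_of_pos_on (hi.mono_set hs2) (fun s hs => ?_) ht1
      refine mul_pos ?_ (hgpos s hs)
      exact sub_pos.2 (Real.rpow_lt_rpow_of_neg (by linarith [hs.2]) (by linarith [hs.1])
        (by linarith))
  rwa [hg] at hpos

theorem caputoCoeff_succ (ha1 : a < 1) (k : ℕ) :
    caputoCoeff a (k + 1) = (k + 1) / (k + 1 - a) * caputoCoeff a k := by
  have hk : (0 : ℝ) ≤ k := Nat.cast_nonneg k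
  have h1 : (k : ℝ) + 1 - a ≠ 0 := by linarith
  rw [caputoCoeff, caputoCoeff, Nat.cast_succ, Real.Gamma_add_one (by positivity),
    show (k : ℝ) + 1 + 1 - a = k + 1 - a + 1 by ring, Real.Gamma_add_one h1, mul_div_mul_comm]

theorem caputoCoeff_pos (ha1 : a < 1) (k : ℕ) : 0 < caputoCoeff a k := by
  have hk : (0 : ℝ) ≤ k := Nat.cast_nonneg k
  exact div_pos (Real.Gamma_pos_of_pos (by linarith)) (Real.Gamma_pos_of_pos (by linarith))

/-- Successive quotients are (k+1)/(k+1-a) > 1. Hence at most one index can be resonant. -/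
theorem strictMono_caputoCoeff (ha0 : 0 < a) (ha1 : a < 1) : StrictMono (caputoCoeff a) := by
  refine strictMono_nat_of_lt_succ fun k => ?_
  have hk : (0 : ℝ) ≤ k := Nat.cast_nonneg k
  rw [caputoCoeff_succ ha1]
  refine lt_mul_of_one_lt_left (caputoCoeff_pos ha1 k) ?_
  rw [one_lt_div (by linarith)]
  linarith

/-- Log-convexity of Γ between k and k+1 gives Γ(k+1-a) ≤ Γ(k)^a Γ(k+1)^(1-a) = Γ(k+1) k^(-a). -/
theorem rpow_le_caputoCoeff (ha0 : 0 < a) (ha1 : a < 1) {k : ℕ} (hk : 1 ≤ k) :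
    (k : ℝ) ^ a ≤ caputoCoeff a k := by
  have hk0 : (0 : ℝ) < k := by exact_mod_cast hk
  have h := Real.Gamma_mul_add_mul_le_rpow_Gamma_mul_rpow_Gamma hk0
    (by linarith : (0 : ℝ) < k + 1) ha0 (sub_pos.2 ha1) (by ring)
  rw [show a * k + (1 - a) * (k + 1) = (k : ℝ) + 1 - a by ring] at h
  have hG := Real.Gamma_pos_of_pos hk0
  have h2 : Real.Gamma k ^ a * Real.Gamma (k + 1) ^ (1 - a) * (k : ℝ) ^ a =
      Real.Gamma (k + 1) := by
    rw [mul_right_comm, mul_comm (Real.Gamma k ^ a), ← Real.mul_rpow hk0.le hG.le,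
      ← Real.Gamma_add_one hk0.ne', ← Real.rpow_add (Real.Gamma_pos_of_pos (by linarith))]
    simp
  rw [caputoCoeff, le_div_iff₀ (Real.Gamma_pos_of_pos (by linarith))]
  calc _ ≤ (k : ℝ) ^ a * (Real.Gamma k ^ a * Real.Gamma (k + 1) ^ (1 - a)) := by gcongr
    _ = _ := by rw [mul_comm, h2]

theorem tendsto_caputoCoeff_atTop (ha0 : 0 < a) (ha1 : a < 1) :
    Filter.Tendsto (caputoCoeff a) Filter.atTop Filter.atTop := by
  refine Filter.tendsto_atTop_mono' _ ?_
    ((tendsto_rpow_atTop ha0).comp tendsto_natCast_atTop_atTop)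
  filter_upwards [Filter.eventually_ge_atTop 1] with k hk using rpow_le_caputoCoeff ha0 ha1 hk

/-- A sequence that tends to infinity and has no zero is bounded away from zero. -/
theorem exists_forall_le_abs_of_tendsto_atTop {D : ℕ → ℝ}
    (h : Filter.Tendsto D Filter.atTop Filter.atTop) (h0 : ∀ k, D k ≠ 0) :
    ∃ δ > 0, ∀ k, δ ≤ |D k| := by
  obtain ⟨N, hN⟩ := Filter.eventually_atTop.1 (h.eventually_ge_atTop 1)
  have hne : (Finset.range (N + 1)).Nonempty := ⟨0, by simp⟩
  obtain ⟨j, -, hj⟩ := Finset.exists_min_image (Finset.range (N + 1)) (fun k => |D k|) hne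
  refine ⟨min 1 |D j|, lt_min one_pos (abs_pos.2 (h0 j)), fun k => ?_⟩
  rcases lt_or_ge k (N + 1) with hk | hk
  · exact (min_le_right _ _).trans (hj k (Finset.mem_range.2 hk))
  · exact (min_le_left _ _).trans ((hN k (by omega)).trans (le_abs_self _))

end CaputoMonomials

/-! ### Sums of real power series and their derivatives -/

section RealSums

open PowerSeries

/-- The sum of a real power series at a real point. -/
noncomputable def realSum (f : PowerSeries ℝ) (x : ℝ) : ℝ := ∑' k, coeff k f * x ^ k

variable {r C C' x : ℝ} {f g : PowerSeries ℝ}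

namespace HasL1Bound

theorem summable_norm_at (hr : 0 ≤ r) (hf : HasL1Bound r f C) (hx : |x| ≤ r) :
    Summable fun k => ‖coeff k f * x ^ k‖ := by
  refine Summable.of_nonneg_of_le (fun k => norm_nonneg _) (fun k => ?_) (hf.summable hr)
  rw [norm_mul, norm_pow, Real.norm_eq_abs, Real.norm_eq_abs]
  gcongr

theorem hasSum_realSum (hr : 0 ≤ r) (hf : HasL1Bound r f C) (hx : |x| ≤ r) :
    HasSum (fun k => coeff k f * x ^ k) (realSum f x) :=
  (hf.summable_norm_at hr hx).of_norm.hasSum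

theorem realSum_add (hr : 0 ≤ r) (hf : HasL1Bound r f C) (hg : HasL1Bound r g C')
    (hx : |x| ≤ r) : realSum (f + g) x = realSum f x + realSum g x := by
  rw [← ((hf.hasSum_realSum hr hx).add (hg.hasSum_realSum hr hx)).tsum_eq, realSum]
  simp only [map_add, add_mul]

theorem realSum_mul (hr : 0 ≤ r) (hf : HasL1Bound r f C) (hg : HasL1Bound r g C')
    (hx : |x| ≤ r) : realSum (f * g) x = realSum f x * realSum g x := by
  rw [realSum, realSum, realSum, tsum_mul_tsum_eq_tsum_sum_antidiagonal_of_summable_norm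
    (hf.summable_norm_at hr hx) (hg.summable_norm_at hr hx)]
  congr 1
  ext k
  rw [coeff_mul, Finset.sum_mul]
  refine Finset.sum_congr rfl fun p hp => ?_
  rw [← Finset.HasAntidiagonal.mem_antidiagonal.1 hp, pow_add]
  ring

theorem realSum_pow (hr : 0 ≤ r) (hf : HasL1Bound r f C) (hx : |x| ≤ r) (n : ℕ) :
    realSum (f ^ n) x = realSum f x ^ n := by
  induction n with
  | zero =>
    rw [pow_zero, pow_zero, realSum, tsum_eq_single 0]
    · simp
    · intro k hk; simp [coeff_one, hk]
  | succ n ih => rw [pow_succ, pow_succ, (hf.pow hr n).realSum_mul hr hf hx, ih]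

theorem realSum_sum {ι : Type*} (s : Finset ι) {F : ι → PowerSeries ℝ} {B : ι → ℝ}
    (hr : 0 ≤ r) (h : ∀ i ∈ s, HasL1Bound r (F i) (B i)) (hx : |x| ≤ r) :
    realSum (∑ i ∈ s, F i) x = ∑ i ∈ s, realSum (F i) x := by
  have h1 := hasSum_sum fun i hi => (h i hi).hasSum_realSum hr hx
  rw [← h1.tsum_eq, realSum]
  simp only [map_sum, Finset.sum_mul]

theorem hasFPowerSeriesOnBall (hr : 0 < r) (hf : HasL1Bound r f C) :
    HasFPowerSeriesOnBall (realSum f) (FormalMultilinearSeries.ofScalars ℝ fun k => coeff k f) 0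
      (ENNReal.ofReal r) where
  r_le := by
    refine FormalMultilinearSeries.le_radius_of_summable_norm (r := r.toNNReal) _ ?_
    simpa [FormalMultilinearSeries.ofScalars_norm, hr.le] using hf.summable hr.le
  r_pos := by simpa using hr
  hasSum := by
    intro y hy
    have hy' : |y| ≤ r := by
      rw [mem_eball, edist_dist, dist_zero_right, Real.norm_eq_abs,
        ENNReal.ofReal_lt_ofReal_iff hr] at hy
      exact hy.le
    simpa [FormalMultilinearSeries.ofScalars_apply_eq, zero_add, smul_eq_mul, mul_comm]
      using hf.hasSum_realSum hr.le hy'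

theorem analyticAt_realSum (hr : 0 < r) (hf : HasL1Bound r f C) (hx : |x| < r) :
    AnalyticAt ℝ (realSum f) x := by
  refine (hf.hasFPowerSeriesOnBall hr).analyticAt_of_mem ?_
  rw [mem_eball, edist_dist, dist_zero_right, Real.norm_eq_abs, ENNReal.ofReal_lt_ofReal_iff hr]
  exact hx

end HasL1Bound

theorem exists_succ_mul_pow_le (hx : 0 ≤ x) (hxr : x < r) :
    ∃ K : ℝ, 0 ≤ K ∧ ∀ k : ℕ, (k + 1) * x ^ k ≤ K * r ^ k := by
  have hr : 0 < r := hx.trans_lt hxr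
  have hq : |x / r| < 1 := by
    rw [abs_of_nonneg (by positivity), div_lt_one hr]; exact hxr
  have h := (tendsto_pow_const_mul_const_pow_of_abs_lt_one 1 hq).add
    (tendsto_pow_const_mul_const_pow_of_abs_lt_one 0 hq)
  obtain ⟨K, hK⟩ := h.bddAbove_range
  have hK' : ∀ k : ℕ, (k + 1) * (x / r) ^ k ≤ K := fun k => by
    have := hK ⟨k, rfl⟩
    simp only [pow_one, pow_zero, one_mul] at this
    linarith
  refine ⟨K, ?_, fun k => ?_⟩
  · have := hK' 0
    norm_num at this
    linarith
  · have := hK' k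
    rw [div_pow, ← mul_div_assoc, div_le_iff₀ (by positivity)] at this
    exact this

theorem HasL1Bound.summable_deriv (hf : HasL1Bound r f C) (hx : 0 < x) (hxr : x < r) :
    Summable fun k : ℕ => (k + 1) * x ^ (k - 1) * |coeff k f| := by
  obtain ⟨K, hK0, hK⟩ := exists_succ_mul_pow_le hx.le hxr
  have hr : 0 < r := hx.trans hxr
  refine Summable.of_nonneg_of_le (fun k => by positivity) (fun k => ?_)
    ((hf.summable hr.le).mul_left ((1 + x⁻¹) * K))
  -- The summand 1 serves k = 0, where k - 1 truncates to 0; the summand x⁻¹ serves k ≥ 1.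
  have h1 : x ^ (k - 1) ≤ (1 + x⁻¹) * x ^ k := by
    rcases k with _ | k
    · simp [hx.le]
    · rw [Nat.add_sub_cancel, pow_succ]
      have : x⁻¹ * (x ^ k * x) = x ^ k := by field_simp
      have h2 : 0 ≤ x ^ k * x := by positivity
      linarith
  have hx' : 0 ≤ 1 + x⁻¹ := by positivity
  calc (k + 1) * x ^ (k - 1) * |coeff k f|
      ≤ (k + 1) * ((1 + x⁻¹) * x ^ k) * |coeff k f| := by gcongr
    _ = (1 + x⁻¹) * ((k + 1) * x ^ k) * |coeff k f| := by ring
    _ ≤ (1 + x⁻¹) * (K * r ^ k) * |coeff k f| :=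
      mul_le_mul_of_nonneg_right (mul_le_mul_of_nonneg_left (hK k) hx') (abs_nonneg _)
    _ = _ := by ring

theorem HasL1Bound.hasDerivAt_realSum (hf : HasL1Bound r f C) (hx : 0 < x) (hxr : x < r) :
    HasDerivAt (realSum f) (∑' k, coeff k f * (k * x ^ (k - 1))) x := by
  obtain ⟨y, hxy, hyr⟩ := exists_between hxr
  have hy : 0 < y := hx.trans hxy
  refine hasDerivAt_tsum_of_isPreconnected (hf.summable_deriv hy hyr) isOpen_Ioo
    (isPreconnected_Ioo (a := 0) (b := y)) (fun k z _ => (hasDerivAt_pow k z).const_mul _)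
    (fun k z hz => ?_) ⟨hx, hxy⟩ ?_ ⟨hx, hxy⟩
  · have : z ^ (k - 1) ≤ y ^ (k - 1) := pow_le_pow_left₀ hz.1.le hz.2.le _
    have hz0 : 0 ≤ z ^ (k - 1) := pow_nonneg hz.1.le _
    rw [norm_mul, Real.norm_eq_abs, Real.norm_eq_abs, mul_comm,
      abs_of_nonneg (by positivity : 0 ≤ (k : ℝ) * z ^ (k - 1))]
    gcongr
    linarith
  · refine (hf.hasSum_realSum (hx.trans hxr).le ?_).summable
    rw [abs_of_pos hx]; exact hxr.le

end RealSums

/-! ### Logarithmic series and their Caputo derivative -/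

section LogSeries

open PowerSeries MeasureTheory

variable {r C C' a b : ℝ} {v c : PowerSeries ℝ}

/-- The function `b + v(x) + c(x) log x` given by two power series. -/
noncomputable def logSeries (b : ℝ) (v c : PowerSeries ℝ) (x : ℝ) : ℝ :=
  b + realSum v x + Real.log x * realSum c x

/-- The `k`-th term of the derivative of `logSeries b v c`. -/
noncomputable def logSeriesDerivTerm (v c : PowerSeries ℝ) (k : ℕ) (s : ℝ) : ℝ :=
  coeff k v * (k * s ^ (k - 1)) + coeff k c * (k * s ^ (k - 1) * Real.log s + s ^ (k - 1))

theorem abs_logSeriesDerivTerm_le {s x : ℝ} (hs : 0 < s) (hsx : s ≤ x) (k : ℕ) :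
    |logSeriesDerivTerm v c k s| ≤
      ((k + 1) * x ^ (k - 1) * |coeff k v| + (k + 1) * x ^ (k - 1) * |coeff k c|) *
        (|Real.log s| + 1) := by
  refine (abs_add_le _ _).trans ?_
  rw [abs_mul (coeff k v), abs_mul (coeff k c)]
  calc _ ≤ |coeff k v| * ((k + 1) * x ^ (k - 1) * (|Real.log s| + 1)) +
        |coeff k c| * ((k + 1) * x ^ (k - 1) * (|Real.log s| + 1)) :=
        add_le_add (mul_le_mul_of_nonneg_left (abs_mul_pow_le hs hsx k) (abs_nonneg _))
          (mul_le_mul_of_nonneg_left (abs_mul_pow_log_le hs hsx k) (abs_nonneg _))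
    _ = _ := by ring

theorem hasDerivAt_logSeries (hv : HasL1Bound r v C) (hc : HasL1Bound r c C')
    (hc0 : constantCoeff c = 0) {x : ℝ} (hx : 0 < x) (hxr : x < r) :
    HasDerivAt (logSeries b v c) (∑' k, logSeriesDerivTerm v c k x) x := by
  have h := ((hv.hasDerivAt_realSum hx hxr).const_add b).add
    ((Real.hasDerivAt_log hx.ne').mul (hc.hasDerivAt_realSum hx hxr))
  have hs : ∀ {f : PowerSeries ℝ} {B : ℝ}, HasL1Bound r f B →
      Summable fun k : ℕ => coeff k f * (k * x ^ (k - 1)) := fun {f B} hf => by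
    refine Summable.of_norm_bounded (hf.summable_deriv hx hxr) fun k => ?_
    rw [norm_mul, Real.norm_eq_abs, Real.norm_eq_abs, mul_comm,
      abs_of_nonneg (by positivity : 0 ≤ (k : ℝ) * x ^ (k - 1))]
    gcongr
    linarith
  have hsum := (hs hv).hasSum.add (((hc.hasSum_realSum (hx.trans hxr).le
    (by rw [abs_of_pos hx]; exact hxr.le)).mul_left x⁻¹).add ((hs hc).hasSum.mul_left (Real.log x)))
  refine h.congr_deriv ?_
  rw [← hsum.tsum_eq]
  congr 1
  ext k
  rw [logSeriesDerivTerm]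
  -- At k = 0 the truncated exponent k - 1 would replace x⁻¹ by 1; the vanishing constant term of c
  -- excludes this.
  rcases k with _ | k
  · simp [hc0]
  · rw [Nat.add_sub_cancel, pow_succ]
    field_simp
    ring

theorem summable_logSeriesDerivBound (hv : HasL1Bound r v C) (hc : HasL1Bound r c C')
    {x : ℝ} (hx : 0 < x) (hxr : x < r) :
    Summable fun k : ℕ =>
      (k + 1) * x ^ (k - 1) * |coeff k v| + (k + 1) * x ^ (k - 1) * |coeff k c| :=
  (hv.summable_deriv hx hxr).add (hc.summable_deriv hx hxr)

theorem summable_logSeriesDerivTerm (hv : HasL1Bound r v C) (hc : HasL1Bound r c C')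
    {x : ℝ} (hx : 0 < x) (hxr : x < r) : Summable fun k => logSeriesDerivTerm v c k x :=
  Summable.of_norm_bounded ((summable_logSeriesDerivBound hv hc hx hxr).mul_right _)
    fun k => abs_logSeriesDerivTerm_le hx le_rfl k

theorem intervalIntegrable_caputo_logSeries (ha1 : a < 1) (hv : HasL1Bound r v C)
    (hc : HasL1Bound r c C') (hc0 : constantCoeff c = 0) {x : ℝ} (hx : 0 < x) (hxr : x < r) :
    IntervalIntegrable (fun s => (x - s) ^ (-a) * deriv (logSeries b v c) s) volume 0 x := by
  have hM := summable_logSeriesDerivBound hv hc hx hxr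
  refine intervalIntegrable_kernel_mul ha1 hx (C := ∑' k : ℕ, ((k + 1) * x ^ (k - 1) *
    |coeff k v| + (k + 1) * x ^ (k - 1) * |coeff k c|)) (measurable_deriv _) fun s hs => ?_
  rw [(hasDerivAt_logSeries hv hc hc0 hs.1 (hs.2.trans hxr)).deriv, ← tsum_mul_right,
    ← Real.norm_eq_abs]
  exact tsum_of_norm_bounded (hM.mul_right _).hasSum
    fun k => abs_logSeriesDerivTerm_le hs.1 hs.2.le k

theorem integral_kernel_mul_logSeriesDerivTerm (ha1 : a < 1) (hv0 : constantCoeff v = 0)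
    (hc0 : constantCoeff c = 0) {x : ℝ} (hx : 0 < x) (k : ℕ) :
    ∫ s in (0 : ℝ)..x, (x - s) ^ (-a) * logSeriesDerivTerm v c k s =
      Real.Gamma (1 - a) * x ^ (-a) *
        ((caputoCoeff a k * coeff k v + caputoLogCoeff a k * coeff k c +
          Real.log x * (caputoCoeff a k * coeff k c)) * x ^ k) := by
  -- The coefficients `caputoCoeff a 0` and `caputoLogCoeff a 0` have no meaning as derivatives;
  -- here they meet only zero coefficients.
  rcases Nat.eq_zero_or_pos k with rfl | hk
  · simp [logSeriesDerivTerm, hv0, hc0]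
  · have e : ∀ s, (x - s) ^ (-a) * logSeriesDerivTerm v c k s =
        coeff k v * ((x - s) ^ (-a) * (k * s ^ (k - 1))) +
        coeff k c * ((x - s) ^ (-a) * (k * s ^ (k - 1) * Real.log s + s ^ (k - 1))) :=
      fun s => by rw [logSeriesDerivTerm]; ring
    simp only [e]
    rw [intervalIntegral.integral_add
        ((intervalIntegrable_kernel_mul_pow ha1 hx k).const_mul _)
        ((intervalIntegrable_kernel_mul_pow_log ha1 hx k).const_mul _),
      intervalIntegral.integral_const_mul, intervalIntegral.integral_const_mul,
      integral_kernel_mul_pow ha1 hx hk, integral_kernel_mul_pow_log ha1 hx hk]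
    ring

/-- Termwise Caputo derivative of `b + v(x) + c(x) log x`. -/
theorem hasSum_caputoDeriv_logSeries (ha1 : a < 1) (hv : HasL1Bound r v C)
    (hc : HasL1Bound r c C') (hv0 : constantCoeff v = 0) (hc0 : constantCoeff c = 0)
    {x : ℝ} (hx : 0 < x) (hxr : x < r) :
    HasSum (fun k => (caputoCoeff a k * coeff k v + caputoLogCoeff a k * coeff k c +
        Real.log x * (caputoCoeff a k * coeff k c)) * x ^ k)
      (x ^ a * caputoDeriv a (logSeries b v c) x) := by
  have hM := summable_logSeriesDerivBound hv hc hx hxr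
  have hΓ : Real.Gamma (1 - a) ≠ 0 := (Real.Gamma_pos_of_pos (by linarith)).ne'
  have hW := intervalIntegrable_kernel_mul_log ha1 hx
  have hsum : HasSum (fun k => ∫ s in (0 : ℝ)..x, (x - s) ^ (-a) * logSeriesDerivTerm v c k s)
      (∫ s in (0 : ℝ)..x, (x - s) ^ (-a) * deriv (logSeries b v c) s) := by
    refine intervalIntegral.hasSum_integral_of_dominated_convergence
      (fun (k : ℕ) s => ((k + 1) * x ^ (k - 1) * |coeff k v| +
        (k + 1) * x ^ (k - 1) * |coeff k c|) * ((x - s) ^ (-a) * (|Real.log s| + 1)))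
      (fun k => ?_) (fun k => ae_of_all _ fun s hs => ?_) (ae_of_all _ fun s hs => ?_) ?_
      (ae_of_all _ fun s hs => ?_)
    · unfold logSeriesDerivTerm
      exact (by fun_prop : Measurable _).aestronglyMeasurable
    · rw [uIoc_of_le hx.le] at hs
      have hp : 0 ≤ (x - s) ^ (-a) := Real.rpow_nonneg (by linarith [hs.2]) _
      rw [norm_mul, Real.norm_of_nonneg hp, mul_left_comm]
      gcongr
      exact abs_logSeriesDerivTerm_le hs.1 hs.2 k
    · exact hM.mul_right _
    · simp only [tsum_mul_right]
      exact hW.const_mul _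
    · rw [uIoc_of_le hx.le] at hs
      rw [(hasDerivAt_logSeries hv hc hc0 hs.1 (hs.2.trans_lt hxr)).deriv]
      exact (summable_logSeriesDerivTerm hv hc hs.1 (hs.2.trans_lt hxr)).hasSum.mul_left _
  simp only [integral_kernel_mul_logSeriesDerivTerm ha1 hv0 hc0 hx] at hsum
  have h := hsum.mul_left (x ^ a * (Real.Gamma (1 - a))⁻¹)
  rw [mul_assoc] at h
  have e : x ^ a * (Real.Gamma (1 - a))⁻¹ * (Real.Gamma (1 - a) * x ^ (-a)) = 1 := by
    rw [mul_assoc, inv_mul_cancel_left₀ hΓ, ← Real.rpow_add hx]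
    simp
  rw [caputoDeriv]
  simpa only [← mul_assoc _ _ (_ * x ^ _), e, one_mul] using h

/-- Writing c = X d turns c(x) log x into (x log x) d(x), and x log x is continuous at 0. -/
theorem continuousOn_logSeries (hr : 0 < r) (hv : HasL1Bound r v C) (hc : HasL1Bound r c C')
    (hc0 : constantCoeff c = 0) {R : ℝ} (hR : R < r) :
    ContinuousOn (logSeries b v c) (Icc 0 R) := by
  have habs : ∀ x ∈ Icc 0 R, |x| < r := fun x hx => by
    rw [abs_of_nonneg hx.1]; exact hx.2.trans_lt hR
  obtain ⟨d, rfl⟩ := X_dvd_iff.2 hc0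
  have hd : HasL1Bound r d (C' / r) := fun N => by
    rw [le_div_iff₀ hr, Finset.sum_mul]
    refine le_trans (le_of_eq ?_) (hc (N + 1))
    rw [Finset.sum_range_succ']
    simp [coeff_succ_X_mul, pow_succ, mul_assoc]
  have hX : HasL1Bound r (X : PowerSeries ℝ) r := by simpa using HasL1Bound.X_pow (r := r) 1 hr.le
  have hXs : ∀ x, realSum X x = x := fun x => by
    rw [realSum, tsum_eq_single 1]
    · simp
    · intro k hk; simp [coeff_X, hk]
  have e : ∀ x ∈ Icc 0 R,
      logSeries b v (X * d) x = b + realSum v x + (x * Real.log x) * realSum d x := by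
    intro x hx
    rw [logSeries, hX.realSum_mul hr.le hd (habs x hx).le, hXs]
    ring
  refine ContinuousOn.congr ?_ e
  have hcv : ∀ {f : PowerSeries ℝ} {B : ℝ}, HasL1Bound r f B →
      ContinuousOn (realSum f) (Icc 0 R) := fun hf x hx =>
    (hf.analyticAt_realSum hr (habs x hx)).continuousAt.continuousWithinAt
  exact ((continuousOn_const.add (hcv hv)).add
    (Real.continuous_mul_log.continuousOn.mul (hcv hd)))

theorem analyticAt_logSeries (hv : HasL1Bound r v C) (hc : HasL1Bound r c C')
    {x : ℝ} (hx : 0 < x) (hxr : x < r) : AnalyticAt ℝ (logSeries b v c) x := by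
  have hx' : |x| < r := by rwa [abs_of_pos hx]
  exact (analyticAt_const.add (hv.analyticAt_realSum (hx.trans hxr) hx')).add
    ((_root_.analyticAt_log hx).mul (hc.analyticAt_realSum (hx.trans hxr) hx'))

theorem logSeries_zero (hv0 : constantCoeff v = 0) : logSeries b v c 0 = b := by
  have : realSum v 0 = 0 := by
    rw [realSum, tsum_eq_single 0]
    · simp [hv0]
    · intro k hk; simp [hk]
  simp [logSeries, this]

end LogSeries

/-! ### Consequences of the growth condition -/

section GrowthCondition

open PowerSeries

/-- An entire function of polynomial growth is a polynomial. -/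
theorem eq_sum_of_differentiable_of_norm_le {g : ℂ → ℂ} (hg : Differentiable ℂ g) {b : ℂ}
    {c H : ℝ} {n : ℕ} (hb : ∀ t, ‖g t‖ ≤ c * ‖t - b‖ ^ n + H) (t : ℂ) :
    g t = ∑ k ∈ Finset.range (n + 1),
      ((k.factorial : ℂ)⁻¹ * iteratedDeriv k g b) * (t - b) ^ k := by
  have hz : ∀ k, n < k → iteratedDeriv k g b = 0 := by
    intro k hk
    have hle : ∀ᶠ R : ℝ in Filter.atTop, ‖iteratedDeriv k g b‖ ≤
        k.factorial * (c * (R ^ n / R ^ k) + H * (1 / R ^ k)) := by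
      filter_upwards [Filter.eventually_gt_atTop 0] with R hR
      refine (Complex.norm_iteratedDeriv_le_of_forall_mem_sphere_norm_le k hR
        (hg.diffContOnCl) (C := c * R ^ n + H) fun z hz => ?_).trans (le_of_eq ?_)
      · rw [mem_sphere_iff_norm] at hz
        simpa [hz] using hb z
      · field_simp
    have hlim : Filter.Tendsto (fun R : ℝ => (k.factorial : ℝ) *
        (c * (R ^ n / R ^ k) + H * (1 / R ^ k))) Filter.atTop (nhds 0) := by
      have h1 : Filter.Tendsto (fun R : ℝ => R ^ n / R ^ k) Filter.atTop (nhds 0) :=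
        tendsto_pow_div_pow_atTop_zero hk
      have h2 : Filter.Tendsto (fun R : ℝ => 1 / R ^ k) Filter.atTop (nhds 0) := by
        simpa using tendsto_pow_div_pow_atTop_zero (𝕜 := ℝ) (p := 0) (q := k) (by omega)
      simpa using ((h1.const_mul c).add (h2.const_mul H)).const_mul (k.factorial : ℝ)
    exact norm_le_zero_iff.1 (ge_of_tendsto hlim hle)
  have hs := Complex.hasSum_taylorSeries_of_entire hg b t
  rw [← hs.tsum_eq, tsum_eq_sum (s := Finset.range (n + 1))]
  · refine Finset.sum_congr rfl fun k _ => ?_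
    rw [smul_eq_mul, smul_eq_mul]; ring
  · intro k hk
    rw [hz k (by simpa using hk)]
    simp

/-- The real part of an analytic function on the real axis is a real power series. -/
theorem AnalyticAt.exists_realSum_eq_re {φ : ℂ → ℂ} (hφ : AnalyticAt ℂ φ 0) :
    ∃ (R C : ℝ) (f : PowerSeries ℝ), 0 < R ∧ HasL1Bound R f C ∧
      ∀ x : ℝ, |x| ≤ R → realSum f x = (φ x).re := by
  obtain ⟨p, ρ, hp⟩ := hφ
  obtain ⟨R, hR0, hRρ⟩ := ENNReal.lt_iff_exists_nnreal_btwn.1 hp.r_pos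
  have hR : (0 : ℝ) < R := by exact_mod_cast hR0
  have hs : Summable fun k => ‖p k‖ * (R : ℝ) ^ k :=
    p.summable_norm_mul_pow (hRρ.trans_le hp.r_le)
  have hf : Summable fun k =>
      |coeff k (PowerSeries.mk fun k => (p.coeff k).re)| * (R : ℝ) ^ k := by
    refine Summable.of_nonneg_of_le (fun k => by positivity) (fun k => ?_) hs
    rw [coeff_mk, p.norm_apply_eq_norm_coef]
    gcongr
    exact Complex.abs_re_le_norm _
  refine ⟨R, _, _, hR, HasL1Bound.of_summable hR.le hf, fun x hx => ?_⟩
  have hxm : (x : ℂ) ∈ Metric.eball (0 : ℂ) ρ := by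
    rw [mem_eball, edist_dist, dist_zero_right, Complex.norm_real, Real.norm_eq_abs]
    refine lt_of_le_of_lt ?_ hRρ
    exact ENNReal.ofReal_le_of_le_toReal (by simpa using hx)
  have h := Complex.hasSum_re (hp.hasSum hxm)
  rw [zero_add] at h
  rw [← h.tsum_eq, realSum]
  congr 1
  ext k
  rw [coeff_mk, p.apply_eq_pow_smul_coeff, smul_eq_mul, ← Complex.ofReal_pow,
    Complex.re_ofReal_mul, mul_comm]

/-- A function analytic near `{0} × ℂ` of polynomial growth in the second variable has, on the
real axis, a real part that is polynomial in the second variable with coefficients that are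
convergent power series in the first. -/
theorem exists_polynomial_coefficients {G : ℂ × ℂ → ℂ} {b c : ℝ} {n : ℕ} {H : ℂ → ℝ}
    (hG : AnalyticOnNhd ℂ G (ball (0 : ℂ) 1 ×ˢ (univ : Set ℂ)))
    (hb : ∀ z ∈ ball (0 : ℂ) 1, ∀ t, ‖G (z, t)‖ ≤ c * ‖t - b‖ ^ n + H z) :
    ∃ (R : ℝ) (A : ℕ → PowerSeries ℝ), 0 < R ∧ R < 1 ∧ (∀ j, ∃ C, HasL1Bound R (A j) C) ∧
      ∀ x ∈ Icc 0 R, ∀ y : ℝ, (G (x, b + y)).re =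
        ∑ j ∈ Finset.range (n + 1), realSum (A j) x * y ^ j := by
  -- A polynomial of degree at most n in t is determined by its values at b, b+1, …, b+n. Lagrange
  -- interpolation thus expresses its coefficients as fixed combinations of functions analytic in z.
  have han : ∀ i : ℕ, AnalyticAt ℂ (fun z : ℂ => G (z, b + i)) 0 := fun i =>
    AnalyticAt.comp₂ (h := G) (hG (0, b + i) (by simp)) analyticAt_id
      analyticAt_const
  choose R C f hR hf hfe using fun i => (han i).exists_realSum_eq_re
  obtain ⟨r, hr0, hr1, hrR⟩ : ∃ r : ℝ, 0 < r ∧ r < 1 ∧ ∀ i ∈ Finset.range (n + 1), r ≤ R i := by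
    obtain ⟨j, -, hj⟩ := Finset.exists_min_image (Finset.range (n + 1)) R ⟨0, by simp⟩
    exact ⟨min (R j) (1 / 2), lt_min (hR j) (by norm_num),
      (min_le_right _ _).trans_lt (by norm_num), fun i hi => (min_le_left _ _).trans (hj i hi)⟩
  have hfr : ∀ i ∈ Finset.range (n + 1), HasL1Bound r (f i) (C i) := fun i hi =>
    (hf i).mono_radius hr0.le (hrR i hi)
  obtain ⟨ℓ, hℓ⟩ : ∃ ℓ : ℕ → Polynomial ℝ,
      ℓ = Lagrange.basis (Finset.range (n + 1)) (fun i : ℕ => (i : ℝ)) := ⟨_, rfl⟩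
  have hterm : ∀ j, ∀ i ∈ Finset.range (n + 1),
      HasL1Bound r (PowerSeries.C ((ℓ i).coeff j) * f i) (|(ℓ i).coeff j| * C i) :=
    fun j i hi => (HasL1Bound.C_const _ hr0.le).mul (hfr i hi) hr0.le
  refine ⟨r, fun j => ∑ i ∈ Finset.range (n + 1), PowerSeries.C ((ℓ i).coeff j) * f i,
    hr0, hr1, fun j => ⟨_, HasL1Bound.sum _ hr0.le (hterm j)⟩, fun x hx y => ?_⟩
  have hxr : |x| ≤ r := by rw [abs_of_nonneg hx.1]; exact hx.2
  have hxb : (x : ℂ) ∈ ball (0 : ℂ) 1 := by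
    rw [mem_ball_zero_iff, Complex.norm_real]; exact hxr.trans_lt hr1
  have hd : Differentiable ℂ fun t => G (x, t) := fun t =>
    (AnalyticAt.comp₂ (h := G) (hG (x, t) ⟨hxb, trivial⟩) analyticAt_const
      analyticAt_id).differentiableAt
  obtain ⟨P, hPdeg, hP⟩ : ∃ P : Polynomial ℝ, P.degree < (n + 1 : ℕ) ∧
      ∀ y : ℝ, (G (x, b + y)).re = P.eval y := by
    refine ⟨∑ k ∈ Finset.range (n + 1), Polynomial.monomial k
      ((k.factorial : ℂ)⁻¹ * iteratedDeriv k (fun t => G (x, t)) b).re, ?_, fun y => ?_⟩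
    · refine (Polynomial.degree_sum_le _ _).trans_lt ?_
      rw [Finset.sup_lt_iff (WithBot.bot_lt_coe _)]
      intro k hk
      refine (Polynomial.degree_monomial_le _ _).trans_lt ?_
      exact_mod_cast Finset.mem_range.1 hk
    · rw [eq_sum_of_differentiable_of_norm_le hd (hb x hxb), Complex.re_sum,
        Polynomial.eval_finsetSum]
      refine Finset.sum_congr rfl fun k _ => ?_
      rw [Polynomial.eval_monomial, add_sub_cancel_left, ← Complex.ofReal_pow,
        Complex.re_mul_ofReal]
  have hint : P = ∑ i ∈ Finset.range (n + 1), Polynomial.C (P.eval (i : ℝ)) * ℓ i := by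
    have h := Lagrange.eq_interpolate (s := Finset.range (n + 1)) (v := fun i : ℕ => (i : ℝ))
      (fun i _ j _ hij => Nat.cast_injective hij) (f := P) (by simpa using hPdeg)
    rwa [Lagrange.interpolate_apply, ← hℓ] at h
  have hPn : P.natDegree < n + 1 := by
    rcases eq_or_ne P 0 with rfl | hP0
    · simp
    · exact (Polynomial.natDegree_lt_iff_degree_lt hP0).2 hPdeg
  rw [hP, Polynomial.eval_eq_sum_range' hPn]
  refine Finset.sum_congr rfl fun j _ => ?_
  congr 1
  rw [HasL1Bound.realSum_sum _ hr0.le (hterm j) hxr]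
  conv_lhs => rw [hint, Polynomial.finsetSum_coeff]
  refine Finset.sum_congr rfl fun i hi => ?_
  have hC : realSum (PowerSeries.C ((ℓ i).coeff j)) x = (ℓ i).coeff j := by
    rw [realSum, tsum_eq_single 0]
    · simp
    · intro k hk; simp [coeff_C, hk]
  rw [(HasL1Bound.C_const _ hr0.le).realSum_mul hr0.le (hfr i hi) hxr, hC,
    hfe i x (hxr.trans (hrR i hi)), Polynomial.coeff_C_mul, ← hP, mul_comm]
  simp

theorem realSum_at_zero (f : PowerSeries ℝ) : realSum f 0 = constantCoeff f := by
  rw [realSum, tsum_eq_single 0]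
  · simp
  · intro k hk; simp [hk]

/-- The linear coefficient of a polynomial function of size `O(y ^ n)` with `n ≥ 2` vanishes. -/
theorem linear_coefficient_eq_zero {n m : ℕ} (hn : 2 ≤ n) (hm : 1 ≤ m) {α : ℕ → ℝ} {c : ℝ}
    (h : ∀ y : ℝ, |∑ j ∈ Finset.range (m + 1), α j * y ^ j| ≤ c * |y| ^ n) : α 1 = 0 := by
  -- The derivative at y = 0 is computed twice: termwise it is α 1, and from the bound it is 0.
  have h1 : HasDerivAt (fun y : ℝ => ∑ j ∈ Finset.range (m + 1), α j * y ^ j)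
      (∑ j ∈ Finset.range (m + 1), α j * (j * (0 : ℝ) ^ (j - 1))) 0 :=
    HasDerivAt.fun_sum fun j _ => (hasDerivAt_pow j 0).const_mul _
  have e : ∑ j ∈ Finset.range (m + 1), α j * (j * (0 : ℝ) ^ (j - 1)) = α 1 := by
    rw [Finset.sum_eq_single_of_mem 1 (by simp; omega)]
    · simp
    · intro j _ hj
      rcases j with _ | _ | j
      · simp
      · exact absurd rfl hj
      · simp
  have h2 : HasDerivAt (fun y : ℝ => ∑ j ∈ Finset.range (m + 1), α j * y ^ j) 0 0 := by
    have h0 := h 0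
    rw [abs_zero, zero_pow (by omega), mul_zero] at h0
    rw [hasDerivAt_iff_isLittleO, abs_nonpos_iff.1 h0]
    simp only [sub_zero, smul_zero]
    refine Asymptotics.IsBigO.trans_isLittleO ?_ (Asymptotics.isLittleO_pow_id (n := n) (by omega))
    refine Asymptotics.IsBigO.of_bound c (Filter.Eventually.of_forall fun y => ?_)
    rw [norm_pow]
    exact h y
  rw [← e]
  exact h1.unique h2

end GrowthCondition

/-! ### Formal solutions with and without resonance -/

section Solution

open PowerSeries

variable {a : ℝ}

theorem exists_linear_formal_solution {D : ℕ → ℝ} {E B : PowerSeries ℝ}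
    (hlim : Filter.Tendsto D Filter.atTop Filter.atTop) (hD : ∀ k, D k ≠ 0)
    (hE0 : constantCoeff E = 0) (hB0 : constantCoeff B = 0) {R C C' : ℝ} (hR : 0 < R)
    (hE : HasL1Bound R E C) (hB : HasL1Bound R B C') :
    ∃ (v : PowerSeries ℝ) (r K : ℝ), 0 < r ∧ r ≤ R ∧ HasL1Bound r v K ∧ constantCoeff v = 0 ∧
      ∀ k, D k * coeff k v = coeff k E + coeff k (B * v) := by
  obtain ⟨δ, hδ, hδD⟩ := exists_forall_le_abs_of_tendsto_atTop hlim hD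
  obtain ⟨v, r, K, hr, hrR, hv, hv0, h⟩ := exists_formal_solution (D := D)
    (A := fun j => if j = 0 then E else B) 1 hδ hδD (by simpa) (by simpa) hR (fun j => by
      by_cases hj : j = 0
      · exact ⟨C, by simpa [hj] using hE⟩
      · exact ⟨C', by simpa [hj] using hB⟩)
  refine ⟨v, r, K, hr, hrR, hv, hv0, fun k => ?_⟩
  rw [h k, ← map_add]
  simp [Finset.sum_range_succ]

/-- Formal solution without logarithm when the linear coefficient is not resonant. -/
theorem exists_formal_solution_of_ne (ha0 : 0 < a) (ha1 : a < 1) {n : ℕ} (hn : 1 ≤ n)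
    {A : ℕ → PowerSeries ℝ} {R : ℝ} (hR : 0 < R) (hA : ∀ j, ∃ C, HasL1Bound R (A j) C)
    (h0 : constantCoeff (A 0) = 0)
    (hne : ∀ k, 1 ≤ k → caputoCoeff a k ≠ constantCoeff (A 1)) :
    ∃ (v : PowerSeries ℝ) (r C : ℝ), 0 < r ∧ r ≤ R ∧ HasL1Bound r v C ∧ constantCoeff v = 0 ∧
      ∀ k, caputoCoeff a k * coeff k v =
        coeff k (∑ j ∈ Finset.range (n + 1), A j * v ^ j) := by
  obtain ⟨γ, hγ⟩ : ∃ γ, γ = constantCoeff (A 1) := ⟨_, rfl⟩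
  rw [← hγ] at hne
  -- The constant term γ of A₁ is moved to the left side. The value 1 at k = 0 is an arbitrary
  -- nonzero number, since v has no constant term.
  obtain ⟨D, hDdef⟩ : ∃ D : ℕ → ℝ, D = fun k => if k = 0 then 1 else caputoCoeff a k - γ :=
    ⟨_, rfl⟩
  have hlim : Filter.Tendsto D Filter.atTop Filter.atTop := by
    refine (Filter.tendsto_atTop_add_const_right _ (-γ)
      (tendsto_caputoCoeff_atTop ha0 ha1)).congr' ?_
    filter_upwards [Filter.eventually_ge_atTop 1] with k hk
    rw [hDdef]
    simp [Nat.one_le_iff_ne_zero.1 hk, sub_eq_add_neg]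
  have hD : ∀ k, D k ≠ 0 := fun k => by
    rw [hDdef]
    by_cases hk : k = 0
    · simp [hk]
    · simpa [hk] using sub_ne_zero.2 (hne k (Nat.one_le_iff_ne_zero.2 hk))
  obtain ⟨δ, hδ, hδD⟩ := exists_forall_le_abs_of_tendsto_atTop hlim hD
  obtain ⟨v, r, C, hr, hrR, hv, hv0, h⟩ := exists_formal_solution (D := D)
    (A := update A 1 (A 1 + PowerSeries.C (-γ))) n hδ hδD (by simpa) (by simp [hγ]) hR
    (fun j => by
      by_cases hj : j = 1
      · obtain ⟨C, hC⟩ := hA 1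
        exact ⟨_, by simpa [hj] using hC.add (HasL1Bound.C_const (-γ) hR.le) hR.le⟩
      · simpa [hj] using hA j)
  refine ⟨v, r, C, hr, hrR, hv, hv0, fun k => ?_⟩
  have hsum : ∑ j ∈ Finset.range (n + 1), update A 1 (A 1 + PowerSeries.C (-γ)) j * v ^ j =
      ∑ j ∈ Finset.range (n + 1), A j * v ^ j + PowerSeries.C (-γ) * v := by
    have : ∀ j, update A 1 (A 1 + PowerSeries.C (-γ)) j * v ^ j =
        A j * v ^ j + if j = 1 then PowerSeries.C (-γ) * v else 0 := fun j => by
      by_cases hj : j = 1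
      · subst hj; simp [add_mul]
      · simp [hj]
    rw [Finset.sum_congr rfl fun j _ => this j, Finset.sum_add_distrib, Finset.sum_ite_eq',
      if_pos (by simp; omega)]
  have hk := h k
  rw [hsum, map_add, coeff_C_mul, hDdef] at hk
  rcases Nat.eq_zero_or_pos k with rfl | hk0
  · simp only [coeff_zero_eq_constantCoeff_apply, hv0, mul_zero, add_zero] at hk ⊢
    exact hk
  · simp only [hk0.ne', if_false] at hk
    linarith

/-- Formal solution with a logarithm for a linear equation with resonance at index `m`. -/
theorem exists_formal_solution_of_eq (ha0 : 0 < a) (ha1 : a < 1) {A₀ A₁ : PowerSeries ℝ}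
    {R C₀ C₁ : ℝ} (hR : 0 < R) (hA₀ : HasL1Bound R A₀ C₀) (hA₁ : HasL1Bound R A₁ C₁)
    (h0 : constantCoeff A₀ = 0) {m : ℕ} (hm : 1 ≤ m) (hres : caputoCoeff a m = constantCoeff A₁) :
    ∃ (v c : PowerSeries ℝ) (r C C' : ℝ), 0 < r ∧ r ≤ R ∧ HasL1Bound r v C ∧
      HasL1Bound r c C' ∧ constantCoeff v = 0 ∧ constantCoeff c = 0 ∧
      (∀ k, caputoCoeff a k * coeff k v + caputoLogCoeff a k * coeff k c =
        coeff k (A₀ + A₁ * v)) ∧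
      ∀ k, caputoCoeff a k * coeff k c = coeff k (A₁ * c) := by
  obtain ⟨γ, hγ⟩ : ∃ γ, γ = constantCoeff A₁ := ⟨_, rfl⟩
  rw [← hγ] at hres
  have hinj := (strictMono_caputoCoeff ha0 ha1).injective
  have hlimq := Filter.tendsto_atTop_add_const_right _ (-γ) (tendsto_caputoCoeff_atTop ha0 ha1)
  obtain ⟨B, hBdef⟩ : ∃ B, B = A₁ + PowerSeries.C (-γ) := ⟨_, rfl⟩
  have hA₁B : A₁ = B + PowerSeries.C γ := by simp [hBdef, add_assoc]
  have hB : HasL1Bound R B (C₁ + |-γ|) :=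
    hBdef ▸ hA₁.add (HasL1Bound.C_const (-γ) hR.le) hR.le
  have hB0 : constantCoeff B = 0 := by simp [hBdef, hγ]
  -- At the resonant index the divisor is 0. Replacing it by 1 solves every equation but the m-th,
  -- whose defect is then exactly the coefficient of X^m in v.
  obtain ⟨D₁, hD₁⟩ : ∃ D : ℕ → ℝ,
      D = fun k => if k = 0 ∨ k = m then 1 else caputoCoeff a k + -γ := ⟨_, rfl⟩
  have hD₁lim : Filter.Tendsto D₁ Filter.atTop Filter.atTop := by
    refine hlimq.congr' ?_
    filter_upwards [Filter.eventually_gt_atTop m] with k hk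
    rw [hD₁]
    exact (if_neg (by omega)).symm
  have hD₁0 : ∀ k, D₁ k ≠ 0 := fun k => by
    rw [hD₁]
    dsimp only
    split_ifs with hk
    · exact one_ne_zero
    · rw [← sub_eq_add_neg, sub_ne_zero, ← hres]
      exact fun e => hk (Or.inr (hinj e))
  obtain ⟨D₂, hD₂⟩ : ∃ D : ℕ → ℝ,
      D = fun k => if k = 0 then 1 else caputoCoeff a (k + m) + -γ := ⟨_, rfl⟩
  have hD₂lim : Filter.Tendsto D₂ Filter.atTop Filter.atTop := by
    refine (hlimq.comp (Filter.tendsto_add_atTop_nat m)).congr' ?_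
    filter_upwards [Filter.eventually_gt_atTop 0] with k hk
    rw [hD₂]
    exact (if_neg (by omega)).symm
  have hD₂0 : ∀ k, D₂ k ≠ 0 := fun k => by
    rw [hD₂]
    dsimp only
    split_ifs with hk
    · exact one_ne_zero
    · rw [← sub_eq_add_neg, sub_ne_zero, ← hres]
      exact fun e => hk (by have := hinj e; omega)
  obtain ⟨v, r₁, K₁, hr₁, hr₁R, hv, hv0, hveq⟩ :=
    exists_linear_formal_solution hD₁lim hD₁0 h0 hB0 hR hA₀ hB
  obtain ⟨d, r₂, K₂, hr₂, hr₂R, hd, hd0, hdeq⟩ :=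
    exists_linear_formal_solution hD₂lim hD₂0 hB0 hB0 hR hB hB
  -- X^m e solves the homogeneous equation: it may start at X^m because λₘ = γ. The logarithm will
  -- carry a multiple of it.
  obtain ⟨e, he⟩ : ∃ e, e = PowerSeries.C 1 + d := ⟨_, rfl⟩
  have heb : HasL1Bound r₂ e (|1| + K₂) :=
    he ▸ (HasL1Bound.C_const 1 hr₂.le).add hd hr₂.le
  have he0 : constantCoeff e = 1 := by simp [he, hd0]
  have heeq : ∀ k, caputoCoeff a (k + m) * coeff k e = coeff k (B * e) + γ * coeff k e := by
    intro k
    rcases Nat.eq_zero_or_pos k with rfl | hk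
    · simp [hB0, hres]
    · have h1 := hdeq k
      have h2 : coeff k e = coeff k d := by simp [he, coeff_one, hk.ne']
      have h3 : B * e = B + B * d := by rw [he]; simp [mul_add]
      simp only [hD₂, hk.ne', if_false] at h1
      rw [h3, map_add, h2]
      linarith
  -- The logarithmic part X^m e log x leaves a nonlogarithmic remainder; X^m w is to cancel it at
  -- all indices above m.
  obtain ⟨E, hE⟩ : ∃ E : PowerSeries ℝ, E = PowerSeries.mk fun k =>
      if k = 0 then 0 else -(caputoLogCoeff a (k + m) * coeff k e) := ⟨_, rfl⟩
  have hE0 : constantCoeff E = 0 := by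
    rw [← coeff_zero_eq_constantCoeff_apply, hE, coeff_mk, if_pos rfl]
  have hr₃ : 0 < r₂ / 2 := by positivity
  obtain ⟨K₃, hEb⟩ : ∃ K, HasL1Bound (r₂ / 2) E K := by
    obtain ⟨K, hK0, hK⟩ := exists_abs_caputoLogCoeff_le ha1
    obtain ⟨L, hL0, hL⟩ := exists_succ_mul_pow_le hr₃.le (half_lt_self hr₂)
    refine ⟨_, HasL1Bound.of_summable hr₃.le (Summable.of_nonneg_of_le
      (fun k => by positivity) (fun k => ?_) ((heb.summable hr₂.le).mul_left ((m + 1) * K * L)))⟩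
    have hc : |coeff k E| ≤ (k + 1) * ((m + 1) * K) * |coeff k e| := by
      rw [hE, coeff_mk]
      split_ifs with hk
      · rw [abs_zero]; positivity
      · rw [abs_neg, abs_mul]
        refine mul_le_mul_of_nonneg_right ((hK _).trans ?_) (abs_nonneg _)
        push_cast
        have : (0 : ℝ) ≤ k * m * K := by positivity
        nlinarith
    calc |coeff k E| * (r₂ / 2) ^ k
        ≤ (k + 1) * ((m + 1) * K) * |coeff k e| * (r₂ / 2) ^ k :=
          mul_le_mul_of_nonneg_right hc (by positivity)
      _ = (m + 1) * K * |coeff k e| * ((k + 1) * (r₂ / 2) ^ k) := by ring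
      _ ≤ (m + 1) * K * |coeff k e| * (L * r₂ ^ k) :=
          mul_le_mul_of_nonneg_left (hL k) (by positivity)
      _ = _ := by ring
  obtain ⟨w, r₄, K₄, hr₄, hr₄R, hw, hw0, hweq⟩ :=
    exists_linear_formal_solution hD₂lim hD₂0 hE0 hB0 hr₃ hEb
      (hB.mono_radius hr₃.le (by linarith))
  have hweq' : ∀ k, caputoCoeff a (k + m) * coeff k w + caputoLogCoeff a (k + m) * coeff k e =
      coeff k (B * w) + γ * coeff k w + if k = 0 then caputoLogCoeff a m else 0 := by
    intro k
    rcases Nat.eq_zero_or_pos k with rfl | hk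
    · simp [hB0, hw0, he0]
    · have h1 := hweq k
      simp only [hD₂, hE, coeff_mk, hk.ne', if_false] at h1 ⊢
      linarith
  -- The remainder left at index m is `caputoLogCoeff a m`; κ scales it so that it cancels the
  -- defect of v.
  obtain ⟨κ, hκ⟩ : ∃ κ, κ * caputoLogCoeff a m = coeff m v :=
    ⟨coeff m v / caputoLogCoeff a m, div_mul_cancel₀ _ (caputoLogCoeff_pos ha0 ha1 hm).ne'⟩
  have hveq' : ∀ k, caputoCoeff a k * coeff k v =
      coeff k A₀ + coeff k (B * v) + γ * coeff k v -
        if k = m then κ * caputoLogCoeff a m else 0 := by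
    intro k
    have h1 := hveq k
    by_cases hk : k = m
    · subst hk
      simp only [hD₁, or_true, if_true, hκ, hres] at h1 ⊢
      linarith
    · rcases Nat.eq_zero_or_pos k with rfl | hk0
      · simp [hv0, h0, hB0, hk]
      · simp only [hD₁, hk, hk0.ne', or_self, if_false] at h1 ⊢
        linarith
  have hshift : ∀ (f : PowerSeries ℝ) (k : ℕ),
      coeff (k + m) (X ^ m * (PowerSeries.C κ * f)) = κ * coeff k f := fun f k => by
    rw [add_comm, coeff_X_pow_mul', if_pos (by omega), Nat.add_sub_cancel_left, coeff_C_mul]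
  have hlow : ∀ (f : PowerSeries ℝ) (k : ℕ), k < m →
      coeff k (X ^ m * (PowerSeries.C κ * f)) = 0 := fun f k hk => by
    rw [coeff_X_pow_mul', if_neg (by omega)]
  have hmul : ∀ f : PowerSeries ℝ, A₁ * (X ^ m * (PowerSeries.C κ * f)) =
      X ^ m * (PowerSeries.C κ * (B * f + PowerSeries.C γ * f)) := fun f => by
    rw [hA₁B]; ring
  obtain ⟨r, hr⟩ : ∃ r, r = min r₁ r₄ := ⟨_, rfl⟩
  have hr0 : 0 < r := hr ▸ lt_min hr₁ hr₄
  have hrr₁ : r ≤ r₁ := hr ▸ min_le_left _ _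
  have hrr₄ : r ≤ r₄ := hr ▸ min_le_right _ _
  have hX := HasL1Bound.X_pow (r := r) m hr0.le
  have hC := HasL1Bound.C_const (r := r) κ hr0.le
  have hv1 := hv.mono_radius hr0.le hrr₁
  have hw1 := hw.mono_radius hr0.le hrr₄
  have he1 := heb.mono_radius hr0.le (show r ≤ r₂ by linarith)
  refine ⟨v + X ^ m * (PowerSeries.C κ * w), X ^ m * (PowerSeries.C κ * e), r, _, _, hr0,
    hrr₁.trans hr₁R, hv1.add (hX.mul (hC.mul hw1 hr0.le) hr0.le) hr0.le,
    hX.mul (hC.mul he1 hr0.le) hr0.le, ?_, ?_, fun k => ?_, fun k => ?_⟩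
  · simp [hv0, hw0]
  · simp [show m ≠ 0 by omega]
  · rw [mul_add, hmul]
    have h1 := hveq' k
    have h2 : coeff k (A₁ * v) = coeff k (B * v) + γ * coeff k v := by
      rw [hA₁B, add_mul, map_add, coeff_C_mul]
    rcases lt_or_ge k m with hk | hk
    · simp only [map_add, hlow _ k hk, h2]
      rw [if_neg hk.ne] at h1
      linarith
    · obtain ⟨i, rfl⟩ := Nat.exists_eq_add_of_le' hk
      have h3 := hweq' i
      simp only [map_add, hshift, h2, coeff_C_mul]
      by_cases hi : i = 0
      · simp only [hi, zero_add, if_true] at h1 h3 ⊢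
        linear_combination h1 + κ * h3
      · simp only [hi, show i + m ≠ m by omega, if_false] at h1 h3 ⊢
        linear_combination h1 + κ * h3
  · rw [hmul]
    rcases lt_or_ge k m with hk | hk
    · simp only [hlow _ k hk, mul_zero]
    · obtain ⟨i, rfl⟩ := Nat.exists_eq_add_of_le' hk
      simp only [map_add, hshift, coeff_C_mul]
      linear_combination κ * heeq i

/-- A logarithmic series that solves `ᶜDᵃ u = x ^ (-a) ∑ⱼ Aⱼ(x) (u - b) ^ j`, `u(0) = b`. -/
theorem exists_logSeries_caputoDeriv_eq (ha0 : 0 < a) (ha1 : a < 1) (b : ℝ) {n : ℕ} (hn : 1 ≤ n)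
    {A : ℕ → PowerSeries ℝ} {R : ℝ} (hR : 0 < R) (hA : ∀ j, ∃ C, HasL1Bound R (A j) C)
    (h0 : constantCoeff (A 0) = 0) (h1 : 2 ≤ n → constantCoeff (A 1) = 0) :
    ∃ (v c : PowerSeries ℝ) (r C C' : ℝ), 0 < r ∧ r ≤ R ∧ HasL1Bound r v C ∧
      HasL1Bound r c C' ∧ constantCoeff v = 0 ∧ constantCoeff c = 0 ∧
      ∀ x, 0 < x → x < r → x ^ a * caputoDeriv a (logSeries b v c) x =
        ∑ j ∈ Finset.range (n + 1), realSum (A j) x * (logSeries b v c x - b) ^ j := by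
  choose B hB using hA
  by_cases hne : ∀ k, 1 ≤ k → caputoCoeff a k ≠ constantCoeff (A 1)
  · obtain ⟨v, r, C, hr, hrR, hv, hv0, h⟩ :=
      exists_formal_solution_of_ne ha0 ha1 hn hR (fun j => ⟨_, hB j⟩) h0 hne
    have hz : HasL1Bound r (0 : PowerSeries ℝ) 0 := fun N => by simp
    refine ⟨v, 0, r, C, 0, hr, hrR, hv, hz, hv0, by simp, fun x hx hxr => ?_⟩
    have hxa : |x| ≤ r := by rw [abs_of_pos hx]; exact hxr.le
    have hs := hasSum_caputoDeriv_logSeries (b := b) ha1 hv hz hv0 (by simp) hx hxr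
    simp only [map_zero, mul_zero, add_zero, h] at hs
    have hterm : ∀ j ∈ Finset.range (n + 1), HasL1Bound r (A j * v ^ j) (B j * C ^ j) :=
      fun j _ => ((hB j).mono_radius hr.le hrR).mul (hv.pow hr.le j) hr.le
    rw [← hs.tsum_eq]
    refine (HasL1Bound.realSum_sum _ hr.le hterm hxa).trans (Finset.sum_congr rfl fun j _ => ?_)
    have hu : logSeries b v 0 x - b = realSum v x := by simp [logSeries, realSum]
    rw [((hB j).mono_radius hr.le hrR).realSum_mul hr.le (hv.pow hr.le j) hxa,
      hv.realSum_pow hr.le hxa, hu]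
  · push Not at hne
    obtain ⟨m, hm, hres⟩ := hne
    -- Resonance forces the constant term of A₁ to be positive, which is impossible for n ≥ 2.
    have hn1 : n = 1 := by
      by_contra hn1
      rw [h1 (by omega)] at hres
      exact (caputoCoeff_pos ha1 m).ne' hres
    subst hn1
    obtain ⟨v, c, r, C, C', hr, hrR, hv, hc, hv0, hc0, h, h'⟩ :=
      exists_formal_solution_of_eq ha0 ha1 hR (hB 0) (hB 1) h0 hm hres
    refine ⟨v, c, r, C, C', hr, hrR, hv, hc, hv0, hc0, fun x hx hxr => ?_⟩
    have hxa : |x| ≤ r := by rw [abs_of_pos hx]; exact hxr.le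
    have hs := hasSum_caputoDeriv_logSeries (b := b) ha1 hv hc hv0 hc0 hx hxr
    have hA0 := (hB 0).mono_radius hr.le hrR
    have hA1 := (hB 1).mono_radius hr.le hrR
    simp only [h, h', add_mul, mul_assoc] at hs
    have hs' := ((hA0.add (hA1.mul hv hr.le) hr.le).hasSum_realSum hr.le hxa).add
      (((hA1.mul hc hr.le).hasSum_realSum hr.le hxa).mul_left (Real.log x))
    rw [hs.unique hs', hA0.realSum_add hr.le (hA1.mul hv hr.le) hxa,
      hA1.realSum_mul hr.le hv hxa, hA1.realSum_mul hr.le hc hxa,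
      Finset.sum_range_succ, Finset.sum_range_one, logSeries]
    ring

end Solution

/-! ### Proof of the theorem -/

theorem theorem3p17 (a b : ℝ) (ha0 : 0 < a) (ha1 : a < 1)
    (f : ℝ → ℝ → ℝ) (F : ℂ → ℂ → ℂ) (hI : AnalyticityCondition a F)
    (hRe : ∀ x ∈ Set.Ioc (0 : ℝ) 1, ∀ y : ℝ, f x y = (F (x : ℂ) (y : ℂ)).re)
    (n₀ : ℕ) (hn₀ : 1 ≤ n₀) (c : ℝ) (hc : 0 ≤ c) (h : ℂ → ℂ) (hh : MemBZero h)
    (hgrowth : ∀ z ∈ puncturedClosedDisc, ∀ t : ℂ,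
      ‖z ^ (a : ℂ) * F z t‖ ≤ c * ‖t - (b : ℂ)‖ ^ n₀ + ‖h z‖) :
    ∃ R₀ : ℝ, 0 < R₀ ∧ R₀ ≤ 1 ∧ ∃ u : ℝ → ℝ,
      IsCaputoSolution a b f R₀ u ∧
      ContinuousOn u (Set.Icc 0 R₀) ∧ AnalyticOnNhd ℝ u (Set.Ioo 0 R₀) := by
  obtain ⟨G, hG, -, hGF⟩ := hI.extension
  have hpunct : ∀ z ∈ ball (0 : ℂ) 1, z ≠ 0 → z ∈ puncturedClosedDisc := fun z hz hz0 =>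
    ⟨ball_subset_closedBall hz, hz0⟩
  -- The growth bound is given only for z ≠ 0; it passes to z = 0 by continuity of the extension.
  have hG0 : ∀ t, ‖G (0, t)‖ ≤ c * ‖t - b‖ ^ n₀ + ‖h 0‖ := fun t => by
    have hGc : ContinuousAt (fun z : ℂ => G (z, t)) 0 :=
      (AnalyticAt.comp₂ (h := G) (hG (0, t) (by simp)) analyticAt_id
        analyticAt_const).continuousAt
    have hhc : ContinuousAt h 0 :=
      (hh.1.differentiableOn.differentiableAt (ball_mem_nhds 0 one_pos)).continuousAt
    have hl : Filter.Tendsto (fun z : ℂ => ‖G (z, t)‖) (nhdsWithin 0 {0}ᶜ) (nhds ‖G (0, t)‖) :=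
      hGc.norm.tendsto.mono_left nhdsWithin_le_nhds
    have hr : Filter.Tendsto (fun z : ℂ => c * ‖t - b‖ ^ n₀ + ‖h z‖) (nhdsWithin 0 {0}ᶜ)
        (nhds (c * ‖t - b‖ ^ n₀ + ‖h 0‖)) :=
      (hhc.norm.tendsto.mono_left nhdsWithin_le_nhds).const_add _
    refine le_of_tendsto_of_tendsto hl hr ?_
    filter_upwards [self_mem_nhdsWithin,
      mem_nhdsWithin_of_mem_nhds (ball_mem_nhds (0 : ℂ) one_pos)] with z hz0 hz
    rw [hGF z (hpunct z hz hz0)]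
    exact hgrowth z (hpunct z hz hz0) t
  have hGb : ∀ z ∈ ball (0 : ℂ) 1, ∀ t, ‖G (z, t)‖ ≤ c * ‖t - b‖ ^ n₀ + ‖h z‖ := by
    intro z hz t
    by_cases hz0 : z = 0
    · rw [hz0]; exact hG0 t
    · rw [hGF z (hpunct z hz hz0)]
      exact hgrowth z (hpunct z hz hz0) t
  obtain ⟨R, A, hR, hR1, hA, hsum⟩ :=
    exists_polynomial_coefficients (H := fun z => ‖h z‖) hG hGb
  have hsmall : ∀ y : ℝ, |∑ j ∈ Finset.range (n₀ + 1), PowerSeries.constantCoeff (A j) * y ^ j| ≤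
      c * |y| ^ n₀ := fun y => by
    have h1 := hsum 0 ⟨le_rfl, hR.le⟩ y
    simp only [realSum_at_zero] at h1
    rw [← h1]
    refine (Complex.abs_re_le_norm _).trans ?_
    simpa [hh.2] using hG0 (b + y)
  have hA0 : PowerSeries.constantCoeff (A 0) = 0 := by
    have h1 := hsmall 0
    rw [abs_zero, zero_pow (by omega), mul_zero, abs_nonpos_iff, Finset.sum_range_succ'] at h1
    simpa using h1
  obtain ⟨v, d, r, C, C', hr, hrR, hv, hd, hv0, hd0, heq⟩ :=
    exists_logSeries_caputoDeriv_eq ha0 ha1 b hn₀ hR hA hA0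
      (fun h2 => linear_coefficient_eq_zero h2 hn₀ hsmall)
  -- Halving the radius keeps the right endpoint inside the interval of convergence.
  have hr2 : r / 2 < r := half_lt_self hr
  have hcont := continuousOn_logSeries (b := b) hr hv hd hd0 hr2
  have hanal : AnalyticOnNhd ℝ (logSeries b v d) (Ioo 0 (r / 2)) := fun x hx =>
    analyticAt_logSeries hv hd hx.1 (hx.2.trans hr2)
  refine ⟨r / 2, by positivity, by linarith, logSeries b v d,
    ⟨hcont, hanal.differentiableOn, logSeries_zero hv0, fun x hx => ?_, fun x hx => ?_⟩,
    hcont, hanal⟩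
  · exact intervalIntegrable_caputo_logSeries ha1 hv hd hd0 hx.1 (hx.2.trans_lt hr2)
  · have hx1 : x < 1 := by linarith [hx.2]
    have hxa : 0 < x ^ a := Real.rpow_pos_of_pos hx.1 a
    have h1 := hsum x ⟨hx.1.le, by linarith [hx.2]⟩ (logSeries b v d x - b)
    rw [← heq x hx.1 (hx.2.trans_lt hr2)] at h1
    have hxp : (x : ℂ) ∈ puncturedClosedDisc := by
      refine ⟨?_, by simpa using hx.1.ne'⟩
      rw [mem_closedBall_zero_iff, Complex.norm_real, Real.norm_eq_abs, abs_of_pos hx.1]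
      exact hx1.le
    -- For x > 0 the factor x^a is real and positive, so it comes out of the real part and can be
    -- cancelled.
    rw [Complex.ofReal_sub, add_sub_cancel, hGF _ hxp, ← Complex.ofReal_cpow hx.1.le,
      Complex.re_ofReal_mul, ← hRe x ⟨hx.1, hx1.le⟩] at h1
    exact (mul_left_cancel₀ hxa.ne' h1).symm
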